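/- Let $N\ge 1$ be an odd integer, and let $r\ge s>1$ be integers. For $M\ge 1$ let $H(M)=\Gamma_1(M)^{\mathrm{ab}}\otimes_{\mathbb Z}\mathbb Z_2$. Put $t=\begin{pmatrix}1&0\\0&2\end{pmatrix}\in \mathrm{GL}_2(\mathbb Q)$ and let $U$ be the Atkin operator on $H(M)$: the $\mathbb Z_2$-linear extension of the composite $$\Gamma_1(M)^{\mathrm{ab}}\longrightarrow (t^{-1}\Gamma_1(M)t\cap\Gamma_1(M))^{\mathrm{ab}}\longrightarrow \Gamma_1(M)^{\mathrm{ab}}$$ of the transfer map with the map induced by $x\mapsto txt^{-1}$. For a $\mathbb Z_2$-module $H$ with an endomorphism $U$, let $A$ be the image of $\mathbb Z_2[X]\to\mathrm{End}_{\mathbb Z_2}(H)$, $X\mapsto U$, let $A^{\mathrm{ord}}$ be the product of those localizations of $A$ at maximal ideals in which $U$ is a unit, and let $H^{\mathrm{ord}}=H\otimes_A A^{\mathrm{ord}}$. For $i\ge 2$ let $\Gamma_i=\ker(\mathbb Z_2^\times\to(\mathbb Z_2/2^i)^\times)$. An element $\gamma\in\Gamma_2$ acts on $H(N2^r)$ through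 conjugation by any $\sigma=\begin{pmatrix}a&b\\c&d\end{pmatrix}\in\Gamma_1(4N)\cap\Gamma_0(2^r)$ with $d\equiv\gamma\pmod{2^r}$. This action commutes with $U$, so that $\Gamma_2$ acts on $H(N2^r)^{\mathrm{ord}}$. Let $\mathfrak a_s H(N2^r)^{\mathrm{ord}}$ be the $\mathbb Z_2$-submodule spanned by all $(\gamma-1)x$ with $\gamma\in\Gamma_s$ and $x\in H(N2^r)^{\mathrm{ord}}$. **Theorem.** The map $H(N2^r)\to H(N2^s)$ induced by the inclusion $\Gamma_1(N2^r)\subseteq\Gamma_1(N2^s)$ commutes with $U$, and the action of $\Gamma_1(4N)\cap\Gamma_0(2^r)$ on $H(N2^r)$ by conjugation commutes with $U$. There is exactly one $\mathbb Z_2$-linear map $$(\Gamma_1(N2^r)^{\mathrm{ab}}\otimes\mathbb Z_2)^{\mathrm{ord}}/\mathfrak a_s\longrightarrow(\Gamma_1(N2^s)^{\mathrm{ab}}\otimes\mathbb Z_2)^{\mathrm{ord}}$$ sending the class of $h\otimes 1$ to $h'\otimes 1$ for all $h\in H(N2^r)$ with image $h'\in H(N2^s)$, and this map is an isomorphism.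 -/

import Mathlib

open scoped TensorProduct MatrixGroups

noncomputable section

namespace TwoAdicControl

/-! ### Ordinary parts -/

section Ordinary

variable {R : Type*} [CommRing R] {M : Type*} [AddCommGroup M] [Module R M]

/-- The image `A` of `R[X]` in `End_R(M)`, where `X` acts on `M` as `U`. -/
abbrev OpAlg (U : Module.End R M) : Subalgebra R (Module.End R M) :=
  (Polynomial.aeval (R := R) U).range

/-- The algebra `A` is commutative, being a quotient of `R[X]`. -/
instance opAlgCommRing (U : Module.End R M) : CommRing (OpAlg U) :=
  { (inferInstance : Ring (OpAlg U)) with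
    mul_comm := by
      rintro ⟨_, f, rfl⟩ ⟨_, g, rfl⟩
      apply Subtype.ext
      change Polynomial.aeval U f * Polynomial.aeval U g
        = Polynomial.aeval U g * Polynomial.aeval U f
      rw [← map_mul, ← map_mul, mul_comm] }

/-- The operator `U`, as an element of `A`. -/
def opGen (U : Module.End R M) : OpAlg U :=
  ⟨U, Polynomial.X, Polynomial.aeval_X U⟩

/-- `A^ord`: the product of the local rings of `A` (its localizations at maximal ideals) in which
the image of `U` is a unit. -/
abbrev OrdAlg (U : Module.End R M) : Type _ :=
  (m : {m : MaximalSpectrum (OpAlg U) //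
      IsUnit (algebraMap (OpAlg U) (Localization.AtPrime m.asIdeal) (opGen U))}) →
    Localization.AtPrime m.1.asIdeal

/-- The ordinary part `M^ord = M ⊗_A A^ord` of `M` with respect to `U`. -/
def OrdPart (U : Module.End R M) : Type _ :=
  M ⊗[OpAlg U] OrdAlg U

instance (U : Module.End R M) : AddCommGroup (OrdPart U) :=
  inferInstanceAs (AddCommGroup (M ⊗[OpAlg U] OrdAlg U))

instance (U : Module.End R M) : Module R (OrdPart U) :=
  inferInstanceAs (Module R (M ⊗[OpAlg U] OrdAlg U))

/-- The canonical map `M → M^ord`, `m ↦ m ⊗ 1`. -/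
def toOrd (U : Module.End R M) : M →ₗ[R] OrdPart U where
  toFun m := m ⊗ₜ[OpAlg U] (1 : OrdAlg U)
  map_add' x y := TensorProduct.add_tmul x y 1
  map_smul' _ _ := rfl

/-- For a set `S` of endomorphisms of `M` commuting with `U`: the submodule of `M^ord` spanned by all
`(f - 1) x` with `f ∈ S` and `x ∈ M^ord`, where `f` acts on `M^ord = M ⊗_A A^ord` as `f ⊗ 1`. -/
def ordSpan (U : Module.End R M) (S : Set (Module.End R M)) : Submodule R (OrdPart U) :=
  Submodule.span R {y | ∃ f ∈ S, ∃ (m : M) (a : OrdAlg U), y = (f m - m) ⊗ₜ[OpAlg U] a}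

end Ordinary

/-! ### Hecke operators on abelianizations -/

section Hecke

variable {T : Type*} [Group T]

/-- The subgroup `t⁻¹ H t ∩ G`, as a subgroup of `G`. -/
def heckeSubgroup (G H : Subgroup T) (t : T) : Subgroup G :=
  (H.comap (MulAut.conj t).toMonoidHom).subgroupOf G

/-- The homomorphism `t⁻¹ H t ∩ G → H`, `x ↦ t x t⁻¹`. -/
def heckeConj (G H : Subgroup T) (t : T) : heckeSubgroup G H t →* H where
  toFun x := ⟨t * ((x : G) : T) * t⁻¹, x.2⟩
  map_one' := by apply Subtype.ext; simp
  map_mul' x y := by apply Subtype.ext; simp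

/-- The Hecke operator `[t] : G^ab → H^ab`: the transfer `G^ab → (t⁻¹ H t ∩ G)^ab` followed by the
map `(t⁻¹ H t ∩ G)^ab → H^ab` induced by conjugation with `t`. -/
def heckeOp (G H : Subgroup T) (t : T) [(heckeSubgroup G H t).FiniteIndex] :
    Abelianization G →* Abelianization H :=
  (Abelianization.map (heckeConj G H t)).comp
    (Abelianization.lift
      (MonoidHom.transfer (Abelianization.of : heckeSubgroup G H t →* _)))

end Hecke

/-! ### The groups `Γ₁(M)` and their `2`-adic homology -/

/-- The congruence subgroup `Γ₁(M)`, inside `GL₂(ℚ)`. -/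
def G1 (M : ℕ) : Subgroup (GL (Fin 2) ℚ) :=
  (CongruenceSubgroup.Gamma1 M).map (Matrix.SpecialLinearGroup.mapGL ℚ)

/-- The matrix `t = diag(1, 2)`. -/
def tMat : GL (Fin 2) ℚ :=
  Matrix.GeneralLinearGroup.mkOfDetNeZero !![1, 0; 0, 2] (by simp)

theorem conj_mem_G1_of_even (M : ℕ) (γ : SL(2, ℤ)) (h1 : γ ∈ CongruenceSubgroup.Gamma1 M)
    (h2 : γ ∈ CongruenceSubgroup.Gamma 2) :
    tMat * Matrix.SpecialLinearGroup.mapGL ℚ γ * tMat⁻¹ ∈ G1 M := by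
  rw [CongruenceSubgroup.Gamma1_mem] at h1
  rw [CongruenceSubgroup.Gamma_mem] at h2
  obtain ⟨b, hb⟩ := (ZMod.intCast_zmod_eq_zero_iff_dvd (γ 0 1) 2).1 h2.2.1
  have hd : γ 0 0 * γ 1 1 - γ 0 1 * γ 1 0 = 1 := by
    rw [← Matrix.det_fin_two]; exact γ.2
  push_cast at hb
  have hdet : (!![γ 0 0, b; 2 * γ 1 0, γ 1 1] : Matrix (Fin 2) (Fin 2) ℤ).det = 1 := by
    rw [Matrix.det_fin_two_of]
    rw [hb] at hd
    linear_combination hd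
  let δ : SL(2, ℤ) := ⟨!![γ 0 0, b; 2 * γ 1 0, γ 1 1], hdet⟩
  have h00 : δ 0 0 = γ 0 0 := rfl
  have h01 : δ 0 1 = b := rfl
  have h10 : δ 1 0 = 2 * γ 1 0 := rfl
  have h11 : δ 1 1 = γ 1 1 := rfl
  have hδ : δ ∈ CongruenceSubgroup.Gamma1 M := by
    rw [CongruenceSubgroup.Gamma1_mem, h00, h10, h11]
    exact ⟨h1.1, h1.2.1, by push_cast; rw [h1.2.2, mul_zero]⟩
  clear_value δ
  refine ⟨δ, hδ, ?_⟩
  rw [eq_mul_inv_iff_mul_eq]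
  apply Units.ext
  ext i j
  fin_cases i <;> fin_cases j <;>
    simp [tMat, Matrix.mul_apply, Fin.sum_univ_two, Matrix.SpecialLinearGroup.mapGL_coe_matrix,
      h00, h01, h10, h11, hb, mul_comm]

instance heckeFiniteIndex (M : ℕ) : (heckeSubgroup (G1 M) (G1 M) tMat).FiniteIndex := by
  let f : CongruenceSubgroup.Gamma1 M →* G1 M :=
    (Matrix.SpecialLinearGroup.mapGL ℚ).subgroupMap (CongruenceSubgroup.Gamma1 M)
  have hf : Function.Surjective f := MonoidHom.subgroupMap_surjective _ _
  let K := (CongruenceSubgroup.Gamma 2).subgroupOf (CongruenceSubgroup.Gamma1 M)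
  have hK : (K.map f).FiniteIndex := by
    refine ⟨fun h => ?_⟩
    have h1 : (K.map f).index ∣ K.index := K.index_map_dvd hf
    rw [h, zero_dvd_iff] at h1
    exact Subgroup.FiniteIndex.index_ne_zero h1
  refine Subgroup.finiteIndex_of_le (H := K.map f) ?_
  rintro _ ⟨x, hx, rfl⟩
  exact conj_mem_G1_of_even M x x.2 hx

/-- The module `Γ₁(M)^ab ⊗ ℤ₂` (the `ℤ₂`-homology of the modular curve when `4 ∣ M`). -/
def Homology (M : ℕ) : Type :=
  ℤ_[2] ⊗[ℤ] Additive (Abelianization (G1 M))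

instance (M : ℕ) : AddCommGroup (Homology M) :=
  inferInstanceAs (AddCommGroup (ℤ_[2] ⊗[ℤ] Additive (Abelianization (G1 M))))

instance (M : ℕ) : Module ℤ_[2] (Homology M) :=
  inferInstanceAs (Module ℤ_[2] (ℤ_[2] ⊗[ℤ] Additive (Abelianization (G1 M))))

/-- The endomorphism of `Γ₁(M)^ab ⊗ ℤ₂` induced by an endomorphism of `Γ₁(M)^ab`. -/
def homologyMap {M M' : ℕ} (f : Abelianization (G1 M) →* Abelianization (G1 M')) :
    Homology M →ₗ[ℤ_[2]] Homology M' :=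
  (MonoidHom.toAdditive f).toIntLinearMap.baseChange ℤ_[2]

/-- The Atkin operator `U` on `Γ₁(M)^ab ⊗ ℤ₂`. -/
def atkinU (M : ℕ) : Module.End ℤ_[2] (Homology M) :=
  homologyMap (heckeOp (G1 M) (G1 M) tMat)

theorem G1_le_of_dvd {M M' : ℕ} (h : M' ∣ M) : G1 M ≤ G1 M' := by
  have key : ∀ a : ℤ, ∀ e : ℤ, (a : ZMod M) = (e : ZMod M) → (a : ZMod M') = (e : ZMod M') := by
    intro a e hae
    have := congrArg (ZMod.castHom h (ZMod M')) hae
    simpa only [map_intCast] using this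
  refine Subgroup.map_mono fun γ hγ => ?_
  rw [CongruenceSubgroup.Gamma1_mem] at hγ ⊢
  exact ⟨by simpa using key _ 1 (by simpa using hγ.1),
    by simpa using key _ 1 (by simpa using hγ.2.1), by simpa using key _ 0 (by simpa using hγ.2.2)⟩

/-- The map `Γ₁(M)^ab ⊗ ℤ₂ → Γ₁(M')^ab ⊗ ℤ₂` induced by the inclusion, for `M' ∣ M`. -/
def levelMap {M M' : ℕ} (h : M' ∣ M) : Homology M →ₗ[ℤ_[2]] Homology M' :=
  homologyMap (Abelianization.map (Subgroup.inclusion (G1_le_of_dvd h)))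

/-! ### The nebentypus action -/

/-- `Γ_s`, the kernel of `ℤ₂ˣ → (ℤ₂/2^s)ˣ`. -/
def Gam (s : ℕ) : Subgroup ℤ_[2]ˣ :=
  (Units.map (PadicInt.toZModPow (p := 2) s).toMonoidHom).ker

/-- `Φ_r^2 = Γ₁(4N) ∩ Γ₀(2^r)`. -/
def Phi (N r : ℕ) : Subgroup SL(2, ℤ) :=
  CongruenceSubgroup.Gamma1 (N * 4) ⊓ CongruenceSubgroup.Gamma0 (2 ^ r)

theorem Phi_le {N : ℕ} (hN : Nat.Coprime 2 N) (r : ℕ) :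
    Phi N r ≤ CongruenceSubgroup.Gamma0 (N * 2 ^ r) := by
  rintro γ ⟨h1, h2⟩
  have h1' := CongruenceSubgroup.Gamma0_mem.1 (CongruenceSubgroup.Gamma1_in_Gamma0 _ h1)
  have h2' := CongruenceSubgroup.Gamma0_mem.1 h2
  rw [ZMod.intCast_zmod_eq_zero_iff_dvd] at h1' h2'
  rw [CongruenceSubgroup.Gamma0_mem, ZMod.intCast_zmod_eq_zero_iff_dvd]
  have h3 : (N : ℤ) ∣ γ 1 0 := dvd_trans (by push_cast; exact dvd_mul_right _ _) h1'
  rw [Nat.cast_mul]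
  refine IsCoprime.mul_dvd ?_ h3 h2'
  exact Nat.isCoprime_iff_coprime.2 ((hN.pow_left r).symm)

/-- `Γ₀(M)` normalizes `Γ₁(M)`. -/
theorem conj_mem_G1 {M : ℕ} (σ : CongruenceSubgroup.Gamma0 M) {x : GL (Fin 2) ℚ} (hx : x ∈ G1 M) :
    Matrix.SpecialLinearGroup.mapGL ℚ (σ : SL(2, ℤ)) * x *
      (Matrix.SpecialLinearGroup.mapGL ℚ (σ : SL(2, ℤ)))⁻¹ ∈ G1 M := by
  obtain ⟨γ, hγ, rfl⟩ := hx
  rw [← map_mul, ← map_inv, ← map_mul]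
  refine Subgroup.mem_map_of_mem _ ?_
  obtain ⟨γ', hγ', rfl⟩ := hγ
  have h1 : (γ' : CongruenceSubgroup.Gamma0 M) ∈ CongruenceSubgroup.Gamma1' M := γ'.2
  have h2 := (inferInstance : (CongruenceSubgroup.Gamma0Map M).ker.Normal).conj_mem _ h1 σ
  exact ⟨⟨_, h2⟩, trivial, rfl⟩

/-- Conjugation by `σ ∈ Φ_r^2` on `Γ₁(N 2^r)`. -/
def conjG1 {N r : ℕ} (hN : Nat.Coprime 2 N) (σ : Phi N r) :
    G1 (N * 2 ^ r) →* G1 (N * 2 ^ r) where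
  toFun x := ⟨_, conj_mem_G1 ⟨σ, Phi_le hN r σ.2⟩ x.2⟩
  map_one' := by apply Subtype.ext; simp
  map_mul' x y := by apply Subtype.ext; simp

/-- The action of `σ ∈ Φ_r^2` on `Γ₁(N 2^r)^ab ⊗ ℤ₂` by conjugation. -/
def conjAct {N r : ℕ} (hN : Nat.Coprime 2 N) (σ : Phi N r) :
    Module.End ℤ_[2] (Homology (N * 2 ^ r)) :=
  homologyMap (Abelianization.map (conjG1 hN σ))

/-- `η_r(σ) = γ mod Γ_r`: the lower right entry of `σ ∈ Φ_r^2` is congruent to `γ` modulo `2^r`.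
Then `γ` acts on `Γ₁(N 2^r)^ab ⊗ ℤ₂` as conjugation by `σ`. -/
def IsLift {N r : ℕ} (σ : Phi N r) (γ : ℤ_[2]ˣ) : Prop :=
  (((σ : SL(2, ℤ)) 1 1 : ℤ) : ZMod (2 ^ r)) = PadicInt.toZModPow (p := 2) r (γ : ℤ_[2])

/-- `𝔞_s M^ord` for `M = Γ₁(N 2^r)^ab ⊗ ℤ₂`: the span of all `(γ - 1) x` with `γ ∈ Γ_s` and
`x ∈ M^ord`. -/
def augOrd {N : ℕ} (hN : Nat.Coprime 2 N) (r s : ℕ) :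
    Submodule ℤ_[2] (OrdPart (atkinU (N * 2 ^ r))) :=
  ordSpan (atkinU (N * 2 ^ r)) {f | ∃ γ ∈ Gam s, ∃ σ : Phi N r, IsLift σ γ ∧ f = conjAct hN σ}

/-- `φ` is induced by the inclusion `Γ₁(N 2^r) ⊆ Γ₁(N 2^s)`: for `M = Γ₁(N 2^r)^ab ⊗ ℤ₂` and
`M' = Γ₁(N 2^s)^ab ⊗ ℤ₂`, the map `φ : M^ord / 𝔞_s M^ord → M'^ord` sends the class of `m ⊗ 1` to
`m' ⊗ 1`, where `m'` is the image of `m` in `M'`. -/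
def IsInduced {N r s : ℕ} (hN : Nat.Coprime 2 N) (hsr : s ≤ r)
    (φ : (OrdPart (atkinU (N * 2 ^ r)) ⧸ augOrd hN r s) →ₗ[ℤ_[2]]
      OrdPart (atkinU (N * 2 ^ s))) : Prop :=
  ∀ m : Homology (N * 2 ^ r),
    φ (Submodule.Quotient.mk (toOrd (atkinU (N * 2 ^ r)) m)) =
      toOrd (atkinU (N * 2 ^ s)) (levelMap (mul_dvd_mul_left N (pow_dvd_pow 2 hsr)) m)

end TwoAdicControl

end

noncomputable section

universe u

namespace TwoAdicControl

/-! ### Finite algebras over a complete Noetherian ring -/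

/-! Put Q = Γ₁(N2^s) ∩ Γ₀(2^r), so that Γ₁(N2^r) ≤ Q ≤ Γ₁(N2^s). The two inclusions are compared on
homology separately, up to powers of U.

From Q to Γ₁(N2^s): conjugation by t doubles the lower left entry, so the Hecke operator of t maps
the homology of Γ₁(M) ∩ Γ₀(2^i) to that of Γ₁(M) ∩ Γ₀(2^(i+1)). Composing it with the inclusion in
either order gives U. Hence U^(r-s) factors through both homologies (`exists_factor_pow`).

From Γ₁(N2^r) to Q: the quotient embeds by the lower right entry into the kernel of (ℤ/2^r)ˣ →
(ℤ/4)ˣ, which is cyclic. For a cyclic quotient generated by g, the kernel on abelianizations is the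
image of g - 1, and this lies in the span defining 𝔞_s (`mem_augSpan_of_H1incl_eq_zero`). On the
cokernel U acts as multiplication by 2, the index occurring in the transfer, so U^r kills this
2-group (`midU_pow_mem_range`).

It remains to pass to ordinary parts. As A is finite over ℤ₂, some power of U is congruent mod 2 to
an idempotent e, with U invertible on eM and topologically nilpotent on (1 - e)M. The map M → M^ord
is surjective with the same kernel as e (`exists_ordinary_projector`). The isomorphism thus becomes
a statement about elements that are topologically nilpotent for U (`ordinary_control`). -/

theorem isAdicComplete_of_finite {R : Type u} [CommRing R] [IsNoetherianRing R] (I : Ideal R)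
    [IsAdicComplete I R] (M : Type u) [AddCommGroup M] [Module R M] [Module.Finite R M] :
    IsAdicComplete I M := by
  rw [← AdicCompletion.of_bijective_iff]
  have h1 := AdicCompletion.ofTensorProduct_bijective_of_finite_of_isNoetherian I M
  let e : R ≃ₗ[R] AdicCompletion I R := LinearEquiv.ofBijective (AdicCompletion.of I R)
    (AdicCompletion.of_bijective_iff.2 inferInstance)
  -- The canonical map from M to its completion is the composite M ≅ R ⊗ M ≅ R^ ⊗ M ≅ M^, where R ≅
  -- R^ by completeness and the last map is bijective because M is finite and R Noetherian.
  have h2 : Function.Bijective fun m : M =>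
      AdicCompletion.ofTensorProduct I M (e.rTensor M ((TensorProduct.lid R M).symm m)) :=
    h1.comp ((e.rTensor M).bijective.comp (TensorProduct.lid R M).symm.bijective)
  convert h2 using 2 with m
  have he : e 1 = 1 := rfl
  simp [he]

theorem exists_isIdempotentElem_pow {M : Type*} [Monoid M] [Finite M] (a : M) :
    ∃ n : ℕ, n ≠ 0 ∧ IsIdempotentElem (a ^ n) := by
  obtain ⟨i, j, hij, h⟩ : ∃ i j : ℕ, i < j ∧ a ^ i = a ^ j := by
    obtain ⟨i, j, hne, h⟩ := Finite.exists_ne_map_eq_of_infinite fun n : ℕ => a ^ n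
    rcases lt_or_gt_of_ne hne with hlt | hlt
    · exact ⟨i, j, hlt, h⟩
    · exact ⟨j, i, hlt, h.symm⟩
  obtain ⟨p, hp, rfl⟩ : ∃ p, 0 < p ∧ j = i + p := ⟨j - i, by omega, by omega⟩
  have key : ∀ k l : ℕ, a ^ (i + l + p * k) = a ^ (i + l) := by
    intro k l
    induction k with
    | zero => simp
    | succ k ih =>
      rw [show i + l + p * (k + 1) = (i + p) + (l + p * k) by ring, pow_add, ← h, ← pow_add,
        ← add_assoc, ih]
  -- The powers of a have period p from exponent i on. This exponent is a multiple of p and at least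
  -- i, so doubling it does not change the power.
  refine ⟨p * (i + 1), by positivity, ?_⟩
  obtain ⟨l, hl⟩ : ∃ l, p * (i + 1) = i + l := ⟨p * (i + 1) - i, by
    have : i + 1 ≤ p * (i + 1) := Nat.le_mul_of_pos_left _ hp
    omega⟩
  rw [IsIdempotentElem, ← pow_add]
  nth_rw 1 [hl]
  rw [key, hl]

/-- Hensel's lemma for X² - X: the derivative 2a - 1 is its own inverse modulo I, because (2a - 1)²
- 1 = 4(a² - a). -/
theorem exists_isIdempotentElem_sub_mem {A : Type*} [CommRing A] (I : Ideal A) [HenselianRing A I]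
    (a : A) (ha : IsIdempotentElem (Ideal.Quotient.mk I a)) :
    ∃ e : A, IsIdempotentElem e ∧ e - a ∈ I := by
  have ha' : a * a - a ∈ I := by
    rw [← Ideal.Quotient.eq, map_mul]
    exact ha
  obtain ⟨e, he, hea⟩ := HenselianRing.is_henselian (I := I) (Polynomial.X ^ 2 - Polynomial.X)
    (Polynomial.monic_X_pow_sub
      (Polynomial.degree_X_le.trans_lt (by norm_num))) a (by simpa [pow_two] using ha')
    (by
      refine IsUnit.of_mul_eq_one (Ideal.Quotient.mk I (2 * a - 1)) ?_
      rw [← map_mul, ← map_one (Ideal.Quotient.mk I), Ideal.Quotient.eq]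
      simp only [Polynomial.derivative_sub, Polynomial.derivative_X_pow, Polynomial.derivative_X,
        Polynomial.eval_sub, Polynomial.eval_mul, Polynomial.eval_pow, Polynomial.eval_X,
        Polynomial.eval_one, Polynomial.eval_C]
      have : (((2 : ℕ) : A) * a ^ (2 - 1) - 1) * (2 * a - 1) - 1 = 4 * (a * a - a) := by
        push_cast; ring
      rw [this]
      exact Ideal.mul_mem_left _ _ ha')
  refine ⟨e, ?_, hea⟩
  have : e ^ 2 - e = 0 := by simpa using he
  rw [IsIdempotentElem, ← pow_two]
  exact sub_eq_zero.1 this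

section FiniteAlgebra

variable (A : Type) [CommRing A] [Algebra ℤ_[2] A] [Module.Finite ℤ_[2] A]

/-- Completeness makes A Henselian along (2), so idempotents lift, and puts 2 in the Jacobson
radical. -/
instance isAdicComplete_span_two : IsAdicComplete (Ideal.span {(2 : A)}) A := by
  have h := isAdicComplete_of_finite (IsLocalRing.maximalIdeal ℤ_[2]) A
  rw [← IsAdicComplete.map_algebraMap_iff (S := A), PadicInt.maximalIdeal_eq_span_p,
    Ideal.map_span, Set.image_singleton] at h
  simpa only [Nat.cast_ofNat, map_ofNat] using h

instance finite_quotient_span_two : Finite (A ⧸ Ideal.span {(2 : A)}) := by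
  have h0 : Finite (ℤ_[2] ⧸ RingHom.ker (PadicInt.toZMod (p := 2))) :=
    Finite.of_injective _ (RingHom.kerLift_injective _)
  have h1 : Finite (A ⧸ (⊤ : Submodule ℤ_[2] A)) := inferInstance
  have h2 := Submodule.finite_quotient_smul (RingHom.ker (PadicInt.toZMod (p := 2)))
    (N := (⊤ : Submodule ℤ_[2] A)) Module.Finite.fg_top
  let f : A →ₗ[ℤ_[2]] A ⧸ Ideal.span {(2 : A)} :=
    (Ideal.Quotient.mkₐ ℤ_[2] (Ideal.span {(2 : A)})).toLinearMap
  have hf : RingHom.ker (PadicInt.toZMod (p := 2)) • (⊤ : Submodule ℤ_[2] A) ≤ LinearMap.ker f := by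
    rw [PadicInt.ker_toZMod, PadicInt.maximalIdeal_eq_span_p, Submodule.smul_le]
    rintro x hx a -
    obtain ⟨y, rfl⟩ := Ideal.mem_span_singleton'.1 hx
    rw [LinearMap.mem_ker]
    refine Ideal.Quotient.eq_zero_iff_mem.2 (Ideal.mem_span_singleton'.2 ⟨y • a, ?_⟩)
    rw [Nat.cast_ofNat, mul_smul, two_smul, smul_add, mul_two]
  refine Finite.of_surjective (Submodule.liftQ _ f hf) fun x => ?_
  obtain ⟨a, rfl⟩ := Ideal.Quotient.mk_surjective x
  exact ⟨Submodule.Quotient.mk a, rfl⟩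

theorem two_mem_of_isMaximal (m : Ideal A) (hm : m.IsMaximal) : (2 : A) ∈ m := by
  have h : Ideal.span {(2 : A)} ≤ Ideal.jacobson ⊥ := HenselianRing.jac
  exact (h.trans (sInf_le ⟨bot_le, hm⟩)) (Ideal.mem_span_singleton_self _)

instance finite_maximalSpectrum : Finite (MaximalSpectrum A) := by
  have : Finite (Ideal (A ⧸ Ideal.span {(2 : A)})) := Finite.of_injective _ SetLike.coe_injective
  refine Finite.of_injective (fun m : MaximalSpectrum A =>
    m.asIdeal.map (Ideal.Quotient.mk (Ideal.span {(2 : A)}))) ?_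
  intro m m' h
  have h' := congrArg (Ideal.comap (Ideal.Quotient.mk (Ideal.span {(2 : A)}))) h
  have key : ∀ m : MaximalSpectrum A, (m.asIdeal.map (Ideal.Quotient.mk (Ideal.span {(2 : A)}))).comap
      (Ideal.Quotient.mk (Ideal.span {(2 : A)})) = m.asIdeal := by
    intro m
    rw [Ideal.comap_map_of_surjective' _ Ideal.Quotient.mk_surjective, Ideal.mk_ker, sup_eq_left,
      Ideal.span_singleton_le_iff_mem]
    exact two_mem_of_isMaximal A _ m.isMaximal
  rw [key, key] at h'
  exact MaximalSpectrum.ext h'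

variable {A}

theorem exists_isIdempotentElem_sub_pow (a : A) :
    ∃ e : A, ∃ n : ℕ, n ≠ 0 ∧ IsIdempotentElem e ∧ e - a ^ n ∈ Ideal.span {(2 : A)} := by
  obtain ⟨n, hn, h⟩ := exists_isIdempotentElem_pow (Ideal.Quotient.mk (Ideal.span {(2 : A)}) a)
  rw [← map_pow] at h
  obtain ⟨e, he, hea⟩ := exists_isIdempotentElem_sub_mem _ _ h
  exact ⟨e, n, hn, he, hea⟩

/-- Since 2 lies in every maximal ideal, e and a power of a agree in every residue field. -/
theorem mem_iff_of_sub_pow_mem {a e : A} {n : ℕ} (hn : n ≠ 0)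
    (h : e - a ^ n ∈ Ideal.span {(2 : A)}) (m : MaximalSpectrum A) :
    e ∈ m.asIdeal ↔ a ∈ m.asIdeal := by
  have h' : e - a ^ n ∈ m.asIdeal :=
    (Ideal.span_singleton_le_iff_mem _).2 (two_mem_of_isMaximal A _ m.isMaximal) h
  rw [← m.isMaximal.isPrime.pow_mem_iff_mem (r := a) n (Nat.pos_of_ne_zero hn)]
  exact ⟨fun he => by simpa using sub_mem he h', fun ha => by simpa using add_mem h' ha⟩

/-- The idempotent of a finite `ℤ₂`-algebra cutting out one of its local factors. -/
theorem exists_isIdempotentElem_notMem (m : MaximalSpectrum A) :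
    ∃ e : A, IsIdempotentElem e ∧ e ∉ m.asIdeal ∧ ∀ m' ≠ m, e ∈ m'.asIdeal := by
  classical
  have := Fintype.ofFinite (MaximalSpectrum A)
  -- Otherwise the finite intersection of the other maximal ideals would lie in the prime m, and so
  -- would one of them.
  obtain ⟨a, ha, ham⟩ : ∃ a, (∀ m' ≠ m, a ∈ m'.asIdeal) ∧ a ∉ m.asIdeal := by
    by_contra! hcon
    have hle : (Finset.univ.erase m).inf (fun m' : MaximalSpectrum A => m'.asIdeal) ≤ m.asIdeal := by
      intro a ha
      refine hcon a fun m' hm' => ?_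
      exact (Finset.inf_le (f := fun m' : MaximalSpectrum A => m'.asIdeal)
        (Finset.mem_erase.2 ⟨hm', Finset.mem_univ _⟩)) ha
    obtain ⟨m', hm', hle'⟩ := (m.isMaximal.isPrime.inf_le').1 hle
    exact (Finset.mem_erase.1 hm').1
      (MaximalSpectrum.ext (m'.isMaximal.eq_of_le m.isMaximal.ne_top hle'))
  obtain ⟨e, n, hn, he, hea⟩ := exists_isIdempotentElem_sub_pow a
  exact ⟨e, he, fun h => ham ((mem_iff_of_sub_pow_mem hn hea m).1 h),
    fun m' hm' => (mem_iff_of_sub_pow_mem hn hea m').2 (ha m' hm')⟩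

end FiniteAlgebra

/-! ### Localizations of a finite ℤ₂-algebra as its direct factors -/

section Localizations

variable {A : Type*} [CommRing A]

theorem algebraMap_eq_one_of_isIdempotentElem {e : A} (he : IsIdempotentElem e) (m : Ideal A)
    [m.IsPrime] (h : e ∉ m) : algebraMap A (Localization.AtPrime m) e = 1 := by
  have hu := (IsLocalization.AtPrime.isUnit_to_map_iff (Localization.AtPrime m) m e).2 h
  exact (hu.mul_eq_left).1 (by rw [← map_mul, he.eq])

theorem algebraMap_eq_zero_of_isIdempotentElem {e : A} (he : IsIdempotentElem e) (m : Ideal A)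
    [m.IsPrime] (h : e ∈ m) : algebraMap A (Localization.AtPrime m) e = 0 := by
  have h1 : (1 - e) ∉ m := fun h1 =>
    (Ideal.ne_top_iff_one m).1 (Ideal.IsPrime.ne_top ‹_›) (by simpa using add_mem h1 h)
  have := algebraMap_eq_one_of_isIdempotentElem he.one_sub m h1
  rwa [map_sub, map_one, sub_eq_self] at this

/-- Vanishing of ea is tested at all maximal ideals: e maps to 0 in the local rings whose maximal
ideal contains it and to 1 in the others. -/
theorem algebraMap_pi_localization_eq_zero_iff {e : A} (he : IsIdempotentElem e) (a : A) :
    algebraMap A ((m : {m : MaximalSpectrum A // e ∉ m.asIdeal}) →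
      Localization.AtPrime m.1.asIdeal) a = 0 ↔ e * a = 0 := by
  constructor
  · intro h
    refine eq_zero_of_localization _ fun J hJ => ?_
    rw [map_mul]
    by_cases hJe : e ∈ J
    · rw [algebraMap_eq_zero_of_isIdempotentElem he J hJe, zero_mul]
    · have := congrFun h ⟨⟨J, hJ⟩, hJe⟩
      rw [Pi.algebraMap_apply] at this
      rw [this, Pi.zero_apply, mul_zero]
  · intro h
    ext m
    rw [Pi.algebraMap_apply, Pi.zero_apply, ← map_zero (algebraMap A _), ← h, map_mul,
      algebraMap_eq_one_of_isIdempotentElem he _ m.2, one_mul]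

variable {A : Type} [CommRing A] [Algebra ℤ_[2] A] [Module.Finite ℤ_[2] A]

theorem algebraMap_atPrime_surjective (m : MaximalSpectrum A) :
    Function.Surjective (algebraMap A (Localization.AtPrime m.asIdeal)) := by
  intro x
  obtain ⟨a, s, rfl⟩ := IsLocalization.exists_mk'_eq m.asIdeal.primeCompl x
  obtain ⟨e, he, hem, hem'⟩ := exists_isIdempotentElem_notMem m
  -- This element agrees with s in the factor at m and with 1 in the others, so it is a unit of A.
  -- The denominator s can therefore be inverted without leaving A.
  have hu : IsUnit (e * s + (1 - e)) := by
    by_contra hnu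
    obtain ⟨M, hM, hmem⟩ := exists_max_ideal_of_mem_nonunits hnu
    by_cases hMm : M = m.asIdeal
    · subst hMm
      have h1 : (1 - e) ∈ m.asIdeal := by
        refine (m.isMaximal.isPrime.mem_or_mem (?_ : e * (1 - e) ∈ _)).resolve_left hem
        rw [mul_sub, he.eq, mul_one, sub_self]
        exact zero_mem _
      have h2 : e * s ∈ m.asIdeal := by simpa using sub_mem hmem h1
      exact ((m.isMaximal.isPrime.mem_or_mem h2).resolve_left hem |> s.2)
    · have h1 : e ∈ M := hem' ⟨M, hM⟩ fun h => hMm (congrArg MaximalSpectrum.asIdeal h)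
      have h2 : (1 : A) ∈ M := by
        have := sub_mem hmem (M.mul_mem_right (s - 1 : A) h1)
        convert this using 1
        ring
      exact (Ideal.ne_top_iff_one M).1 hM.ne_top h2
  obtain ⟨v, hv⟩ := hu.exists_right_inv
  refine ⟨a * v, ?_⟩
  rw [IsLocalization.eq_mk'_iff_mul_eq, ← map_mul]
  have hs : algebraMap A (Localization.AtPrime m.asIdeal) (e * s + (1 - e)) =
      algebraMap A _ (s : A) := by
    rw [map_add, map_mul, map_sub, map_one, algebraMap_eq_one_of_isIdempotentElem he _ hem]
    ring
  rw [map_mul, ← hs, ← map_mul, mul_assoc, mul_comm v, hv, mul_one]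

/-- Each coordinate lifts to A; the lifts are glued with the idempotents of the finitely many local
factors. -/
theorem algebraMap_pi_localization_surjective (P : MaximalSpectrum A → Prop) :
    Function.Surjective (algebraMap A ((m : {m : MaximalSpectrum A // P m}) →
      Localization.AtPrime m.1.asIdeal)) := by
  classical
  intro x
  have := Fintype.ofFinite {m : MaximalSpectrum A // P m}
  choose y hy using fun m : {m : MaximalSpectrum A // P m} =>
    algebraMap_atPrime_surjective m.1 (x m)
  choose e he hem hem' using fun m : {m : MaximalSpectrum A // P m} =>
    exists_isIdempotentElem_notMem m.1
  refine ⟨∑ m, e m * y m, ?_⟩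
  ext m
  rw [Pi.algebraMap_apply, map_sum, Finset.sum_eq_single m]
  · rw [map_mul, algebraMap_eq_one_of_isIdempotentElem (he m) _ (hem m), one_mul, hy]
  · intro m' _ hne
    rw [map_mul, algebraMap_eq_zero_of_isIdempotentElem (he m') _
      (hem' m' m.1 fun h => hne (Subtype.ext h.symm)), zero_mul]
  · simp

end Localizations

/-! ### The ordinary part of a finitely generated `ℤ₂`-module -/

section BaseChange

variable {A B H : Type*} [CommRing A] [CommRing B] [Algebra A B] [AddCommGroup H] [Module A H]

theorem tmul_algebraMap (h : H) (a : A) :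
    h ⊗ₜ[A] algebraMap A B a = (a • h) ⊗ₜ[A] (1 : B) := by
  rw [Algebra.algebraMap_eq_smul_one, ← TensorProduct.smul_tmul]

/-- If `A → B` is the projection onto the factor `eA`, then `x ⊗ 1 = 0` in `H ⊗ B` if and only if
`e x = 0`. -/
theorem tmul_one_eq_zero_iff {e : A} (he : IsIdempotentElem e)
    (hsurj : Function.Surjective (algebraMap A B)) (key : ∀ a, algebraMap A B a = 0 ↔ e * a = 0)
    (x : H) : x ⊗ₜ[A] (1 : B) = 0 ↔ e • x = 0 := by
  constructor
  · intro hx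
    -- Multiplication by e factors through B as an A-linear g : B → A with g 1 = e. Applying H ⊗ g
    -- to x ⊗ 1 gives e x.
    have hker : LinearMap.ker (Algebra.linearMap A B) ≤
        LinearMap.ker (LinearMap.toSpanSingleton A A e) := by
      intro a ha
      rw [LinearMap.mem_ker, LinearMap.toSpanSingleton_apply, smul_eq_mul, mul_comm]
      exact (key a).1 ha
    let q := (Algebra.linearMap A B).quotKerEquivOfSurjective hsurj
    let g : B →ₗ[A] A :=
      (Submodule.liftQ _ (LinearMap.toSpanSingleton A A e) hker).comp q.symm.toLinearMap
    have hq : q.symm 1 = Submodule.Quotient.mk 1 := by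
      rw [LinearEquiv.symm_apply_eq]
      exact (map_one (algebraMap A B)).symm
    have hg : g 1 = e := by
      change Submodule.liftQ _ (LinearMap.toSpanSingleton A A e) hker (q.symm 1) = e
      rw [hq]
      exact one_smul A e
    have h1 := congrArg (fun y => TensorProduct.rid A H (LinearMap.lTensor H g y)) hx
    simpa [hg] using h1
  · intro hx
    have h1 : algebraMap A B e = 1 := by
      rw [← sub_eq_zero, ← map_one (algebraMap A B), ← map_sub, key, mul_sub,
        he.eq, mul_one, sub_self]
    rw [← h1, tmul_algebraMap, hx, TensorProduct.zero_tmul]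

end BaseChange

section OrdinaryProjector

variable {H : Type} [AddCommGroup H] [Module ℤ_[2] H] (U : Module.End ℤ_[2] H)

theorem opAlg_apply_mem {D : Submodule ℤ_[2] H} (hD : ∀ x ∈ D, U x ∈ D) (a : OpAlg U) :
    ∀ x ∈ D, (a : Module.End ℤ_[2] H) x ∈ D := by
  obtain ⟨_, p, rfl⟩ := a
  induction p using Polynomial.induction_on' with
  | add p q hp hq => exact fun x hx => by simpa using D.add_mem (hp x hx) (hq x hx)
  | monomial n c =>
    intro x hx
    have : ∀ n : ℕ, (U ^ n) x ∈ D := by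
      intro n
      induction n with
      | zero => simpa using hx
      | succ n ih => rw [pow_succ', Module.End.mul_apply]; exact hD _ ih
    simpa [Polynomial.aeval_monomial, Module.algebraMap_end_apply] using D.smul_mem c (this n)

theorem commute_opAlg {f : Module.End ℤ_[2] H} (hf : Commute f U) (a : OpAlg U) :
    Commute f (a : Module.End ℤ_[2] H) := by
  obtain ⟨_, p, rfl⟩ := a
  induction p using Polynomial.induction_on' with
  | add p q hp hq => simpa using hp.add_right hq
  | monomial n c =>
    change Commute f (Polynomial.aeval U (Polynomial.monomial n c))
    rw [Polynomial.aeval_monomial]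
    exact Commute.mul_right (Algebra.commutes c f).symm (hf.pow_right n)

instance finite_opAlg [Module.Finite ℤ_[2] H] : Module.Finite ℤ_[2] (OpAlg U) := by
  have h := (Algebra.IsIntegral.isIntegral (R := ℤ_[2]) U).fg_adjoin_singleton
  rw [Algebra.adjoin_singleton_eq_range_aeval] at h
  exact Module.Finite.iff_fg.2 h

theorem toOrd_eq_tmul_algebraMap (a : OpAlg U) (h : H) :
    (h ⊗ₜ[OpAlg U] (algebraMap (OpAlg U) (OrdAlg U) a) : H ⊗[OpAlg U] OrdAlg U) =
      toOrd U ((a : Module.End ℤ_[2] H) h) :=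
  tmul_algebraMap h a

theorem algebraMap_ordAlg_eq_zero_iff {e : OpAlg U} (he : IsIdempotentElem e)
    (h : ∀ m : MaximalSpectrum (OpAlg U), e ∈ m.asIdeal ↔ opGen U ∈ m.asIdeal) (a : OpAlg U) :
    algebraMap (OpAlg U) (OrdAlg U) a = 0 ↔ e * a = 0 := by
  rw [← algebraMap_pi_localization_eq_zero_iff he]
  have key : ∀ m : MaximalSpectrum (OpAlg U),
      IsUnit (algebraMap (OpAlg U) (Localization.AtPrime m.asIdeal) (opGen U)) ↔
        e ∉ m.asIdeal := fun m => by
    rw [h, IsLocalization.AtPrime.isUnit_to_map_iff (Localization.AtPrime m.asIdeal) m.asIdeal]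
    rfl
  constructor
  · intro h0
    ext m
    exact congrFun h0 ⟨m.1, (key m.1).2 m.2⟩
  · intro h0
    ext m
    exact congrFun h0 ⟨m.1, (key m.1).1 m.2⟩

/-- The submodule of `M` spanned by all `(f - 1) m` with `f ∈ S`. -/
def augSpan (S : Set (Module.End ℤ_[2] H)) : Submodule ℤ_[2] H :=
  Submodule.span ℤ_[2] {y | ∃ f ∈ S, ∃ m : H, y = f m - m}

variable {U} in
theorem apply_mem_augSpan {S : Set (Module.End ℤ_[2] H)} (hS : ∀ f ∈ S, Commute f U) :
    ∀ x ∈ augSpan S, U x ∈ augSpan S := by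
  intro x hx
  induction hx using Submodule.span_induction with
  | mem x hx =>
    obtain ⟨f, hf, m, rfl⟩ := hx
    refine Submodule.subset_span ⟨f, hf, U m, ?_⟩
    rw [map_sub, ← Module.End.mul_apply, ← (hS f hf).eq, Module.End.mul_apply]
  | zero => simp
  | add x y _ _ hx hy => rw [map_add]; exact add_mem hx hy
  | smul c x _ hx => rw [map_smul]; exact Submodule.smul_mem _ c hx

variable [Module.Finite ℤ_[2] H]

theorem algebraMap_ordAlg_surjective :
    Function.Surjective (algebraMap (OpAlg U) (OrdAlg U)) :=
  algebraMap_pi_localization_surjective _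

theorem toOrd_surjective : Function.Surjective (toOrd U) := by
  intro x
  induction x using TensorProduct.induction_on with
  | zero => exact ⟨0, map_zero _⟩
  | tmul h a =>
    obtain ⟨a, rfl⟩ := algebraMap_ordAlg_surjective U a
    exact ⟨_, (toOrd_eq_tmul_algebraMap U a h).symm⟩
  | add x y hx hy =>
    obtain ⟨x, rfl⟩ := hx
    obtain ⟨y, rfl⟩ := hy
    exact ⟨x + y, map_add _ _ _⟩

theorem toOrd_eq_zero_iff {e : OpAlg U} (he : IsIdempotentElem e)
    (h : ∀ m : MaximalSpectrum (OpAlg U), e ∈ m.asIdeal ↔ opGen U ∈ m.asIdeal) (x : H) :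
    toOrd U x = 0 ↔ (e : Module.End ℤ_[2] H) x = 0 :=
  tmul_one_eq_zero_iff he (algebraMap_ordAlg_surjective U) (algebraMap_ordAlg_eq_zero_iff U he h) x

/-- The ordinary projector: an idempotent `e` of `A` such that `U` is invertible on the image of `e`
and topologically nilpotent on its kernel, the latter being the kernel of `M → M^ord`. -/
theorem exists_ordinary_projector : ∃ (e v b : OpAlg U) (n : ℕ), IsIdempotentElem e ∧
    v * opGen U * e = e ∧ opGen U ^ n * (1 - e) = 2 * b ∧
    ∀ x : H, toOrd U x = 0 ↔ (e : Module.End ℤ_[2] H) x = 0 := by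
  obtain ⟨e, n, hn, he, hmem⟩ := exists_isIdempotentElem_sub_pow (opGen U)
  obtain ⟨b, hb⟩ := Ideal.mem_span_singleton'.1 hmem
  -- Here U^n = e - 2b, so U^n acts on the factor of e as 1 - 2b, which is a unit as 2 lies in every
  -- maximal ideal. With c its inverse, c U^(n-1) inverts U there; on the factor of 1 - e, U^n is
  -- -2b.
  have hunit : IsUnit (1 - 2 * b) := by
    by_contra hnu
    obtain ⟨M, hM, hM'⟩ := exists_max_ideal_of_mem_nonunits hnu
    refine (Ideal.ne_top_iff_one M).1 hM.ne_top ?_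
    simpa using add_mem hM' (M.mul_mem_right b (two_mem_of_isMaximal _ M hM))
  obtain ⟨c, hc⟩ := hunit.exists_left_inv
  have he' : e * e = e := he
  obtain ⟨k, rfl⟩ := Nat.exists_eq_add_one_of_ne_zero hn
  refine ⟨e, c * opGen U ^ k, -(b * (1 - e)), k + 1, he, ?_, ?_,
    toOrd_eq_zero_iff U he (mem_iff_of_sub_pow_mem hn hmem)⟩
  · rw [pow_succ] at hb
    linear_combination e * hc + c * e * hb + c * he'
  · linear_combination (1 - e) * hb - he'

variable {U}

/-- Elements of `M` that are topologically nilpotent for `U` modulo `D` map to the image of `D` in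
`M^ord`. -/
theorem toOrd_mem_map {D : Submodule ℤ_[2] H} (hD : ∀ x ∈ D, U x ∈ D) {h : H}
    (hh : ∀ k : ℕ, ∃ (m : ℕ) (x : H), (U ^ m) h - (2 ^ k : ℤ_[2]) • x ∈ D) :
    toOrd U h ∈ D.map (toOrd U) := by
  obtain ⟨e, v, b, n, he, hv, hb, hker⟩ := exists_ordinary_projector U
  have hpow : ∀ m : ℕ, v ^ m * e * opGen U ^ m = e := by
    intro m
    induction m with
    | zero => simp
    | succ m ih =>
      calc v ^ (m + 1) * e * opGen U ^ (m + 1)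
          = (v ^ m * e * opGen U ^ m) * (v * opGen U) := by ring
        _ = e := by rw [ih, mul_comm, hv]
  -- For every k, e h = v^m e (U^m h) lies in D + 2^k H. The quotient H / D is finitely generated
  -- over ℤ₂, hence 2-adically separated.
  have hmem : (e : Module.End ℤ_[2] H) h ∈ D := by
    rw [← Submodule.Quotient.mk_eq_zero, ← Submodule.mem_bot ℤ_[2],
      ← IsHausdorff.iInf_pow_smul
        (inferInstance : IsHausdorff (IsLocalRing.maximalIdeal ℤ_[2]) (H ⧸ D)), Submodule.mem_iInf]
    intro k
    obtain ⟨m, x, hx⟩ := hh k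
    have h1 := opAlg_apply_mem U hD (v ^ m * e) _ hx
    have h2 : ((v ^ m * e : OpAlg U) : Module.End ℤ_[2] H) ((U ^ m) h) =
        (e : Module.End ℤ_[2] H) h :=
      congrArg (fun a : OpAlg U => (a : Module.End ℤ_[2] H) h) (hpow m)
    rw [map_sub, h2, map_smul, ← Submodule.Quotient.mk_eq_zero, Submodule.Quotient.mk_sub,
      sub_eq_zero, Submodule.Quotient.mk_smul] at h1
    rw [h1]
    refine Submodule.smul_mem_smul (Ideal.pow_mem_pow ?_ k) trivial
    rw [PadicInt.maximalIdeal_eq_span_p]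
    exact Ideal.mem_span_singleton_self _
  refine ⟨_, hmem, ?_⟩
  rw [← sub_eq_zero, ← map_sub, hker, map_sub, sub_eq_zero]
  exact congrArg (fun a : OpAlg U => (a : Module.End ℤ_[2] H) h) he.eq

/-- The kernel of e is where U^n = 2b, and b commutes with U, so U^(nk) = 2^k b^k there. -/
theorem exists_pow_apply_of_toOrd_eq_zero {h : H} (hh : toOrd U h = 0) (k : ℕ) :
    ∃ (m : ℕ) (x : H), (U ^ m) h = (2 ^ k : ℤ_[2]) • x := by
  obtain ⟨e, v, b, n, he, hv, hb, hker⟩ := exists_ordinary_projector U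
  have h0 := (hker h).1 hh
  have h1 : (U ^ n) h = (2 : ℤ_[2]) • (b : Module.End ℤ_[2] H) h := by
    have h2 := congrArg (fun a : OpAlg U => (a : Module.End ℤ_[2] H) h) hb
    have h3 : ((opGen U ^ n * (1 - e) : OpAlg U) : Module.End ℤ_[2] H) h =
        (U ^ n) (h - (e : Module.End ℤ_[2] H) h) := rfl
    have h4 : ((2 * b : OpAlg U) : Module.End ℤ_[2] H) h =
        (2 : ℤ_[2]) • (b : Module.End ℤ_[2] H) h := by
      rw [two_mul, two_smul]
      rfl
    rw [← h4, ← h2, h3, h0, sub_zero]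
  refine ⟨n * k, ((b : Module.End ℤ_[2] H) ^ k) h, ?_⟩
  have hcomm : Commute (U ^ n) (b : Module.End ℤ_[2] H) :=
    commute_opAlg U ((Commute.refl U).pow_left n) b
  induction k with
  | zero => simp
  | succ k ih =>
    rw [mul_add_one, add_comm, pow_add, Module.End.mul_apply, ih, map_smul,
      ← Module.End.mul_apply, (hcomm.pow_right k).eq, Module.End.mul_apply, h1, map_smul, smul_smul,
      ← pow_succ, pow_succ (b : Module.End ℤ_[2] H), Module.End.mul_apply]

/-- As v inverts U on eH, e y = U^m (v^m e y) lies in W, and e y has the same class as y in the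
ordinary part. -/
theorem exists_mem_toOrd_eq {W : Submodule ℤ_[2] H} {m : ℕ} (hW : ∀ y : H, (U ^ m) y ∈ W) (y : H) :
    ∃ w ∈ W, toOrd U w = toOrd U y := by
  obtain ⟨e, v, b, n, he, hv, hb, hker⟩ := exists_ordinary_projector U
  have hpow : opGen U ^ m * (v ^ m * e) = e := by
    clear hW
    induction m with
    | zero => simp
    | succ m ih =>
      calc opGen U ^ (m + 1) * (v ^ (m + 1) * e)
          = opGen U ^ m * (v ^ m * (v * opGen U * e)) := by ring
        _ = e := by rw [hv, ih]
  have h1 : (U ^ m) (((v ^ m * e : OpAlg U) : Module.End ℤ_[2] H) y) =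
        (e : Module.End ℤ_[2] H) y :=
      congrArg (fun a : OpAlg U => (a : Module.End ℤ_[2] H) y) hpow
  refine ⟨(e : Module.End ℤ_[2] H) y, h1 ▸ hW _, ?_⟩
  rw [← sub_eq_zero, ← map_sub, hker, map_sub, sub_eq_zero]
  exact congrArg (fun a : OpAlg U => (a : Module.End ℤ_[2] H) y) he.eq

/-- As A → A^ord is surjective and f commutes with A, the second tensor factor can be absorbed into
m. -/
theorem ordSpan_eq_map {S : Set (Module.End ℤ_[2] H)} (hS : ∀ f ∈ S, Commute f U) :
    ordSpan U S = (augSpan S).map (toOrd U) := by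
  rw [augSpan, Submodule.map_span, ordSpan]
  congr 1
  ext y
  constructor
  · rintro ⟨f, hf, m, a, rfl⟩
    obtain ⟨a, rfl⟩ := algebraMap_ordAlg_surjective U a
    refine ⟨_, ⟨f, hf, (a : Module.End ℤ_[2] H) m, rfl⟩, ?_⟩
    rw [toOrd_eq_tmul_algebraMap, map_sub (a : Module.End ℤ_[2] H), ← Module.End.mul_apply f,
      (commute_opAlg U (hS f hf) a).eq, Module.End.mul_apply]
  · rintro ⟨_, ⟨f, hf, m, rfl⟩, rfl⟩
    exact ⟨f, hf, m, 1, rfl⟩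

end OrdinaryProjector

/-! ### A criterion for an isomorphism on ordinary parts -/

section Control

variable {H H' : Type} [AddCommGroup H] [Module ℤ_[2] H] [Module.Finite ℤ_[2] H]
  [AddCommGroup H'] [Module ℤ_[2] H'] [Module.Finite ℤ_[2] H']
  {U : Module.End ℤ_[2] H} {U' : Module.End ℤ_[2] H'}

/-- A map of finitely generated `ℤ₂`-modules that is an isomorphism up to topologically nilpotent
elements, after dividing by `(f - 1) M` for all `f ∈ S`, induces an isomorphism on ordinary parts. -/
theorem ordinary_control (S : Set (Module.End ℤ_[2] H)) (hS : ∀ f ∈ S, Commute f U)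
    (π : H →ₗ[ℤ_[2]] H') (hπ : ∀ m, π (U m) = U' (π m)) (hπS : ∀ f ∈ S, ∀ m, π (f m) = π m)
    (hsurj : ∃ n : ℕ, ∀ y, (U' ^ n) y ∈ LinearMap.range π)
    (hinj : ∀ h, (∀ k : ℕ, ∃ (m : ℕ) (x : H'), (U' ^ m) (π h) = (2 ^ k : ℤ_[2]) • x) →
      ∀ k : ℕ, ∃ (m : ℕ) (x : H), (U ^ m) h - (2 ^ k : ℤ_[2]) • x ∈ augSpan S) :
    (∃! φ : (OrdPart U ⧸ ordSpan U S) →ₗ[ℤ_[2]] OrdPart U',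
      ∀ m, φ (Submodule.Quotient.mk (toOrd U m)) = toOrd U' (π m)) ∧
    ∀ φ : (OrdPart U ⧸ ordSpan U S) →ₗ[ℤ_[2]] OrdPart U',
      (∀ m, φ (Submodule.Quotient.mk (toOrd U m)) = toOrd U' (π m)) → Function.Bijective φ := by
  have hπpow : ∀ (n : ℕ) (m : H), π ((U ^ n) m) = (U' ^ n) (π m) := by
    intro n m
    induction n with
    | zero => simp
    | succ n ih => rw [pow_succ', pow_succ', Module.End.mul_apply, Module.End.mul_apply, hπ, ih]
  -- The algebras generated by U and U' are not related by a map, so the ordinary part is not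
  -- functorial by base change. Its kernel consists of the topologically nilpotent elements, and π
  -- preserves these.
  have hker : LinearMap.ker (toOrd U) ≤ LinearMap.ker ((toOrd U').comp π) := by
    intro h hh
    have h1 : toOrd U' (π h) ∈ (⊥ : Submodule ℤ_[2] H').map (toOrd U') := by
      refine toOrd_mem_map (by simp) fun k => ?_
      obtain ⟨m, x, hx⟩ := exists_pow_apply_of_toOrd_eq_zero hh k
      refine ⟨m, π x, ?_⟩
      rw [Submodule.mem_bot, sub_eq_zero, ← hπpow, hx, map_smul]
    simpa using h1
  let φ₀ : OrdPart U →ₗ[ℤ_[2]] OrdPart U' := (Submodule.liftQ _ ((toOrd U').comp π) hker).comp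
    ((toOrd U).quotKerEquivOfSurjective (toOrd_surjective U)).symm.toLinearMap
  have hφ₀ : ∀ m, φ₀ (toOrd U m) = toOrd U' (π m) := by
    intro m
    have : ((toOrd U).quotKerEquivOfSurjective (toOrd_surjective U)).symm (toOrd U m) =
        Submodule.Quotient.mk m := by
      rw [LinearEquiv.symm_apply_eq]
      rfl
    simp only [φ₀, LinearMap.comp_apply, LinearEquiv.coe_coe, this]
    rfl
  have hspan : ordSpan U S ≤ LinearMap.ker φ₀ := by
    rw [ordSpan_eq_map hS, augSpan, Submodule.map_span, Submodule.span_le]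
    rintro _ ⟨_, ⟨f, hf, m, rfl⟩, rfl⟩
    rw [SetLike.mem_coe, LinearMap.mem_ker, hφ₀, map_sub, hπS f hf, sub_self, map_zero]
  refine ⟨⟨Submodule.liftQ _ φ₀ hspan, fun m => hφ₀ m, fun ψ hψ => ?_⟩, fun φ hφ => ⟨?_, ?_⟩⟩
  · refine Submodule.linearMap_qext _ (LinearMap.ext fun x => ?_)
    obtain ⟨m, rfl⟩ := toOrd_surjective U x
    exact (hψ m).trans (hφ₀ m).symm
  · refine (injective_iff_map_eq_zero φ).2 fun x hx => ?_
    obtain ⟨x, rfl⟩ := Submodule.Quotient.mk_surjective _ x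
    obtain ⟨h, rfl⟩ := toOrd_surjective U x
    rw [hφ] at hx
    rw [Submodule.Quotient.mk_eq_zero, ordSpan_eq_map hS]
    exact toOrd_mem_map (apply_mem_augSpan hS) (hinj h (exists_pow_apply_of_toOrd_eq_zero hx))
  · intro y
    obtain ⟨y, rfl⟩ := toOrd_surjective U' y
    obtain ⟨n, hn⟩ := hsurj
    obtain ⟨_, ⟨h, rfl⟩, hw⟩ := exists_mem_toOrd_eq hn y
    exact ⟨Submodule.Quotient.mk (toOrd U h), (hφ h).trans hw⟩

end Control

/-! ### Functoriality of the transfer -/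

section Transfer

open Subgroup

variable {G K A A' : Type*} [Group G] [Group K] [CommGroup A] [CommGroup A']

theorem inv_mul_mul_section_mem {L : Subgroup G} {s : G ⧸ L → G} (hs : ∀ q, (s q : G ⧸ L) = q)
    (g : G) (q : G ⧸ L) : (s q)⁻¹ * (g * s (g⁻¹ • q)) ∈ L := by
  rw [← QuotientGroup.eq, hs, ← smul_eq_mul, ← MulAction.Quotient.smul_coe, hs, smul_inv_smul]

/-- The section is arbitrary so that coset representatives can be transported along a homomorphism.
-/
theorem transfer_eq_prod {L : Subgroup G} [L.FiniteIndex] [Fintype (G ⧸ L)] (ϕ : L →* A)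
    {s : G ⧸ L → G} (hs : ∀ q, (s q : G ⧸ L) = q) (g : G) :
    MonoidHom.transfer ϕ g =
      ∏ q : G ⧸ L, ϕ ⟨(s q)⁻¹ * (g * s (g⁻¹ • q)), inv_mul_mul_section_mem hs g q⟩ := by
  rw [MonoidHom.transfer_def ϕ ⟨Set.range s, isComplement_range_left hs⟩,
    leftTransversals.diff]
  refine Finset.prod_congr (by congr!) fun q _ => ?_
  congr 2
  rw [smul_apply_eq_smul_apply_inv_smul, IsComplement.leftQuotientEquiv_apply hs,
    IsComplement.leftQuotientEquiv_apply hs, smul_eq_mul]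

theorem map_transfer {L : Subgroup G} [L.FiniteIndex] (ϕ : L →* A) (F : A →* A') (g : G) :
    F (MonoidHom.transfer ϕ g) = MonoidHom.transfer (F.comp ϕ) g := by
  let _ := L.fintypeQuotientOfFiniteIndex
  rw [transfer_eq_prod ϕ Quotient.out_eq', transfer_eq_prod (F.comp ϕ) Quotient.out_eq', map_prod]
  rfl

/-- The transfer of the restriction of `χ` is `χ` to the power of the index. -/
theorem transfer_comp_subtype {L : Subgroup G} [L.FiniteIndex] (χ : G →* A) (g : G) :
    MonoidHom.transfer (χ.comp L.subtype) g = χ g ^ L.index := by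
  let _ := L.fintypeQuotientOfFiniteIndex
  rw [transfer_eq_prod _ Quotient.out_eq']
  simp only [MonoidHom.comp_apply, Subgroup.coe_subtype, map_mul, map_inv, Finset.prod_mul_distrib,
    Finset.prod_inv_distrib, Finset.prod_const, Finset.card_univ]
  -- Translation by g⁻¹ permutes the cosets, so the contributions of the representatives cancel and
  -- one χ g per coset remains.
  rw [Fintype.prod_bijective _ (MulAction.bijective g⁻¹) (fun q : G ⧸ L => χ (Quotient.out (g⁻¹ • q)))
    (fun q => χ (Quotient.out q)) fun _ => rfl, mul_comm, mul_assoc, mul_inv_cancel, mul_one,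
    Subgroup.index_eq_card, Nat.card_eq_fintype_card]

/-- The transfer is natural for a homomorphism `f : K → G` inducing a bijection `K / L₀ → G / L`. -/
theorem transfer_apply_map {L : Subgroup G} [L.FiniteIndex] {L₀ : Subgroup K} [L₀.FiniteIndex]
    (f : K →* G) (hL : ∀ k, k ∈ L₀ ↔ f k ∈ L) (hG : ∀ x : G, ∃ k : K, ∃ y ∈ L, x = f k * y)
    (ϕ : L →* A) (ψ : L₀ →* A) (hψ : ∀ y : L₀, ψ y = ϕ ⟨f y, (hL y).1 y.2⟩) (k : K) :
    MonoidHom.transfer ϕ (f k) = MonoidHom.transfer ψ k := by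
  let _ := L.fintypeQuotientOfFiniteIndex
  let _ := L₀.fintypeQuotientOfFiniteIndex
  let e₀ : K ⧸ L₀ → G ⧸ L := Quotient.map' f fun a b hab => by
    rw [QuotientGroup.leftRel_apply] at hab ⊢
    rw [← map_inv, ← map_mul]
    exact (hL _).1 hab
  have he₀ : Function.Bijective e₀ := by
    constructor
    · rintro ⟨a⟩ ⟨b⟩ hab
      have := QuotientGroup.eq.1 hab
      rw [← map_inv, ← map_mul] at this
      exact QuotientGroup.eq.2 ((hL _).2 this)
    · rintro ⟨x⟩
      obtain ⟨a, y, hy, rfl⟩ := hG x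
      refine ⟨(a : K ⧸ L₀), QuotientGroup.eq.2 ?_⟩
      rwa [inv_mul_cancel_left]
  let e := Equiv.ofBijective e₀ he₀
  have hsmul : ∀ q, e.symm ((f k)⁻¹ • e q) = k⁻¹ • q := by
    rintro ⟨a⟩
    rw [Equiv.symm_apply_eq]
    change ((f k)⁻¹ • (f a : G ⧸ L)) = ((f (k⁻¹ * a) : G) : G ⧸ L)
    rw [map_mul, map_inv]
    rfl
  -- Representatives for G / L are the images under f of those for K / L₀; the two transfers then
  -- agree factor by factor.
  have hs : ∀ q : G ⧸ L, ((f (Quotient.out (e.symm q)) : G) : G ⧸ L) = q := by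
    intro q
    have : ((f (Quotient.out (e.symm q)) : G) : G ⧸ L) =
      e (Quotient.mk'' (Quotient.out (e.symm q))) := rfl
    rw [this, Quotient.out_eq', Equiv.apply_symm_apply]
  rw [transfer_eq_prod ϕ hs, transfer_eq_prod ψ Quotient.out_eq', ← e.prod_comp]
  refine Finset.prod_congr rfl fun q _ => ?_
  rw [hψ]
  congr 2
  simp only [map_mul, map_inv, hsmul, Equiv.symm_apply_apply]

end Transfer

/-! ### Naturality of Hecke operators -/

section HeckeNaturality

variable {T : Type*} [Group T]

theorem mem_heckeSubgroup {G H : Subgroup T} {t : T} {x : G} :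
    x ∈ heckeSubgroup G H t ↔ t * (x : T) * t⁻¹ ∈ H := Iff.rfl

theorem heckeOp_of {G H : Subgroup T} {t : T} [(heckeSubgroup G H t).FiniteIndex] (g : G) :
    heckeOp G H t (Abelianization.of g) =
      MonoidHom.transfer (Abelianization.of.comp (heckeConj G H t)) g := by
  rw [heckeOp, MonoidHom.comp_apply, Abelianization.lift_apply_of, map_transfer]
  rfl

/-- The conditions make f a bijection on the cosets defining the two transfers. The maps f and f'
may differ: conjugation by σ on the source corresponds to conjugation by tσt⁻¹ on the target. -/
theorem heckeOp_comp_map {G H K J : Subgroup T} {t : T} [(heckeSubgroup G H t).FiniteIndex]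
    [(heckeSubgroup K J t).FiniteIndex] (f : K →* G) (f' : J →* H)
    (hmem : ∀ x : K, t * (x : T) * t⁻¹ ∈ J ↔ t * (f x : T) * t⁻¹ ∈ H)
    (hconj : ∀ (x : K) (y : J), (y : T) = t * (x : T) * t⁻¹ → (f' y : T) = t * (f x : T) * t⁻¹)
    (hsurj : ∀ x : G, ∃ (k : K) (y : G), t * (y : T) * t⁻¹ ∈ H ∧ x = f k * y) :
    (heckeOp G H t).comp (Abelianization.map f) =
      (Abelianization.map f').comp (heckeOp K J t) := by
  refine Abelianization.hom_ext _ _ (MonoidHom.ext fun k => ?_)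
  simp only [MonoidHom.comp_apply, Abelianization.map_of, heckeOp_of, map_transfer]
  refine transfer_apply_map f hmem hsurj _ _ ?_ k
  intro y
  simp only [MonoidHom.comp_apply, Abelianization.map_of]
  congr 1
  exact Subtype.ext (hconj y _ rfl)

/-- A character of `G` that is invariant under conjugation by `t` is raised to the power of the
degree by the Hecke operator. -/
theorem lift_heckeOp {G : Subgroup T} {t : T} [(heckeSubgroup G G t).FiniteIndex]
    {A : Type*} [CommGroup A] (χ : G →* A)
    (hχ : ∀ x y : G, (y : T) = t * (x : T) * t⁻¹ → χ y = χ x) (x : Abelianization G) :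
    Abelianization.lift χ (heckeOp G G t x) =
      Abelianization.lift χ x ^ (heckeSubgroup G G t).index := by
  obtain ⟨g, rfl⟩ : ∃ g, Abelianization.of g = x := QuotientGroup.mk'_surjective _ x
  rw [heckeOp_of, map_transfer, Abelianization.lift_apply_of, ← transfer_comp_subtype]
  congr 2
  refine MonoidHom.ext fun y => ?_
  exact hχ (y : G) (heckeConj G G t y) rfl

end HeckeNaturality

/-! ### Abelianizations in an extension with cyclic quotient -/

section CyclicExtension

variable {T : Type*} [Group T] {Γ G : Subgroup T}

theorem eq_one_of_of_eq_one (hΓ : Γ ≤ G) {g : T} (hg : g ∈ Subgroup.normalizer (Γ : Set T))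
    (hgen : ∀ x ∈ G, ∃ n : ℤ, ∃ y ∈ Γ, x = g ^ n * y) {Q : Type*} [CommGroup Q] (p : Γ →* Q)
    (hp : ∀ y y' : Γ, (y' : T) = g * y * g⁻¹ → p y' = p y) (x : Γ)
    (hx : Abelianization.of (Subgroup.inclusion hΓ x) = 1) : p x = 1 := by
  have hmem : ∀ (n : ℤ) (y : Γ), g ^ n * y * (g ^ n)⁻¹ ∈ Γ := fun n y =>
    (Subgroup.mem_normalizer_iff.1 (zpow_mem hg n) y).1 y.2
  have hpn : ∀ (n : ℤ) (y : Γ), p ⟨_, hmem n y⟩ = p y := by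
    have step : ∀ (n : ℤ) (y : Γ), p ⟨_, hmem (n + 1) y⟩ = p ⟨_, hmem n y⟩ := fun n y =>
      hp _ _ (by simp only [add_comm n, zpow_add, zpow_one, mul_inv_rev, mul_assoc])
    intro n y
    induction n with
    | zero => congr 1; ext; simp
    | succ n ih => rw [step, ih]
    | pred n ih => rw [← ih, ← step]; congr 2; simp
  have hle : commutator G ≤ p.ker.map (Subgroup.inclusion hΓ) := by
    rw [commutator_def, Subgroup.commutator_le]
    rintro ⟨a, ha⟩ - ⟨b, hb⟩ -
    obtain ⟨m, y, hy, rfl⟩ := hgen a ha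
    obtain ⟨n, z, hz, rfl⟩ := hgen b hb
    -- The commutator of g^m y and g^n z is the product of the conjugates of y by g^m, of z y⁻¹ by
    -- g^(m+n) and of z⁻¹ by g^n. A g-invariant p into a commutative group kills it.
    refine ⟨⟨_, hmem m ⟨y, hy⟩⟩ * ⟨_, hmem (m + n) (⟨z, hz⟩ * ⟨y, hy⟩⁻¹)⟩ *
      ⟨_, hmem n ⟨z, hz⟩⁻¹⟩, ?_, ?_⟩
    · rw [SetLike.mem_coe, MonoidHom.mem_ker, map_mul, map_mul, hpn, hpn, hpn, map_mul, map_inv,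
        map_inv, mul_comm (p ⟨z, hz⟩), mul_inv_cancel_left, mul_inv_cancel]
    · ext
      simp only [commutatorElement_def, Subgroup.coe_inclusion, Subgroup.coe_mul, Subgroup.coe_inv,
        zpow_add]
      have : g ^ m * g ^ n = g ^ n * g ^ m := by rw [← zpow_add, ← zpow_add, add_comm]
      simp only [mul_inv_rev, mul_assoc, inv_mul_cancel_left]
      rw [← mul_assoc (g ^ n)⁻¹ (g ^ m)⁻¹, ← mul_inv_rev, this, mul_inv_rev]
      simp only [mul_assoc, inv_mul_cancel_left]
  have hx' : Subgroup.inclusion hΓ x ∈ commutator G := by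
    rw [← Abelianization.ker_of]
    exact hx
  obtain ⟨x', hx'', h⟩ := hle hx'
  rw [← Subgroup.inclusion_injective hΓ h]
  exact hx''

/-- If `G / Γ` is generated by the class of `g`, the kernel of `Γ^ab → G^ab` consists of the
`c(x) x⁻¹`, for `c` the conjugation by `g`. -/
theorem exists_eq_map_div_self (hΓ : Γ ≤ G) {g : T} (hg : g ∈ Subgroup.normalizer (Γ : Set T))
    (hgen : ∀ x ∈ G, ∃ n : ℤ, ∃ y ∈ Γ, x = g ^ n * y) (c : Γ →* Γ)
    (hc : ∀ x, (c x : T) = g * x * g⁻¹) (x : Abelianization Γ)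
    (hx : Abelianization.map (Subgroup.inclusion hΓ) x = 1) :
    ∃ y, Abelianization.map c y / y = x := by
  let d : Abelianization Γ →* Abelianization Γ := Abelianization.map c / MonoidHom.id _
  obtain ⟨x, rfl⟩ : ∃ y, Abelianization.of y = x := QuotientGroup.mk'_surjective _ x
  -- Take for p the projection of Γ to the cokernel of c - 1 on Γ^ab, which is invariant under g by
  -- construction.
  have := eq_one_of_of_eq_one hΓ hg hgen
    ((QuotientGroup.mk' d.range).comp Abelianization.of) (by
      intro y y' hy
      have : y' = c y := Subtype.ext (hy.trans (hc y).symm)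
      subst this
      refine (QuotientGroup.eq.2 (show _ ∈ d.range from ⟨Abelianization.of y, ?_⟩)).symm
      change Abelianization.map c (Abelianization.of y) / Abelianization.of y = _
      rw [Abelianization.map_of, div_eq_mul_inv, mul_comm]) x hx
  exact (QuotientGroup.eq_one_iff _).1 this

end CyclicExtension

open CongruenceSubgroup Matrix.SpecialLinearGroup

/-! ### Subgroups of `SL₂(ℤ)` and conjugation by `t` -/

theorem tMat_conj_eq_iff (γ δ : SL(2, ℤ)) :
    tMat * mapGL ℚ γ * tMat⁻¹ = mapGL ℚ δ ↔
      δ 0 0 = γ 0 0 ∧ γ 0 1 = 2 * δ 0 1 ∧ δ 1 0 = 2 * γ 1 0 ∧ δ 1 1 = γ 1 1 := by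
  rw [mul_inv_eq_iff_eq_mul, Units.ext_iff, ← Matrix.ext_iff]
  simp [tMat, Matrix.mul_apply, Fin.sum_univ_two, Matrix.SpecialLinearGroup.mapGL_coe_matrix,
    Fin.forall_fin_two]
  norm_cast
  constructor
  · rintro ⟨⟨h1, h2⟩, h3, h4⟩
    exact ⟨h1.symm, by linarith, h3.symm, by linarith⟩
  · rintro ⟨h1, h2, h3, h4⟩
    exact ⟨⟨h1.symm, by linarith⟩, h3.symm, by linarith⟩

theorem exists_tMat_conj_eq {γ : SL(2, ℤ)} (h : Even (γ 0 1)) :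
    ∃ δ : SL(2, ℤ), tMat * mapGL ℚ γ * tMat⁻¹ = mapGL ℚ δ := by
  obtain ⟨b, hb⟩ := h.two_dvd
  have hd := Matrix.det_fin_two (γ : Matrix (Fin 2) (Fin 2) ℤ)
  rw [γ.2] at hd
  refine ⟨⟨!![γ 0 0, b; 2 * γ 1 0, γ 1 1], ?_⟩, (tMat_conj_eq_iff _ _).2 ⟨rfl, hb, rfl, rfl⟩⟩
  rw [Matrix.det_fin_two_of]
  rw [hb] at hd
  linear_combination -hd

/-- The image of a subgroup of `SL₂(ℤ)` in `GL₂(ℚ)`. -/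
abbrev imGL (P : Subgroup SL(2, ℤ)) : Subgroup (GL (Fin 2) ℚ) := P.map (mapGL ℚ)

theorem mapGL_mem_imGL {P : Subgroup SL(2, ℤ)} {γ : SL(2, ℤ)} : mapGL ℚ γ ∈ imGL P ↔ γ ∈ P :=
  Subgroup.mem_map_iff_mem mapGL_injective

/-- Conjugation by `t` takes those elements of `P` with even upper right entry into `P'`. -/
def ConjInto (P P' : Subgroup SL(2, ℤ)) : Prop :=
  ∀ γ ∈ P, ∀ δ : SL(2, ℤ), δ 0 0 = γ 0 0 → δ 1 0 = 2 * γ 1 0 → δ 1 1 = γ 1 1 → δ ∈ P'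

theorem ConjInto.mem_iff {P P' : Subgroup SL(2, ℤ)} (h : ConjInto P P') {γ : SL(2, ℤ)}
    (hγ : γ ∈ P) : tMat * mapGL ℚ γ * tMat⁻¹ ∈ imGL P' ↔ Even (γ 0 1) := by
  constructor
  · rintro ⟨δ, -, hδ⟩
    rw [((tMat_conj_eq_iff γ δ).1 hδ.symm).2.1]
    exact even_two_mul _
  · intro he
    obtain ⟨δ, hδ⟩ := exists_tMat_conj_eq he
    obtain ⟨h1, -, h3, h4⟩ := (tMat_conj_eq_iff γ δ).1 hδ
    rw [hδ]
    exact mapGL_mem_imGL.2 (h γ hγ δ h1 h3 h4)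

/-- The conditions on a subgroup `P` of `SL₂(ℤ)` under which the elements with even upper right
entry form a subgroup of index two with representatives `1, (1 1; 0 1)`. -/
structure IsOddLevel (P : Subgroup SL(2, ℤ)) : Prop where
  T_mem : ModularGroup.T ∈ P
  odd_apply : ∀ γ ∈ P, Odd (γ 1 1)

theorem T_inv_mul_apply_zero_one (γ : SL(2, ℤ)) :
    (ModularGroup.T⁻¹ * γ) 0 1 = γ 0 1 - γ 1 1 := by
  simp [Matrix.mul_apply, Fin.sum_univ_two, sub_eq_add_neg]

theorem T_inv_mul_apply_one (γ : SL(2, ℤ)) (i : Fin 2) :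
    (ModularGroup.T⁻¹ * γ) 1 i = γ 1 i := by
  simp [ModularGroup.T_inv_mul_apply_one]

/-- Multiplication by T⁻¹ subtracts the odd lower right entry from the upper right one, which
changes its parity. -/
theorem IsOddLevel.xor_even {P : Subgroup SL(2, ℤ)} (hP : IsOddLevel P) {γ : SL(2, ℤ)}
    (hγ : γ ∈ P) : Xor (Even ((ModularGroup.T⁻¹ * γ) 0 1)) (Even (γ 0 1)) := by
  have h := hP.odd_apply γ hγ
  rw [T_inv_mul_apply_zero_one, Int.even_sub, ← Int.not_odd_iff_even (n := γ 1 1)]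
  simp only [h, not_true_eq_false, iff_false]
  exact (em _).elim (fun h => Or.inr ⟨h, by simpa using h⟩) (fun h => Or.inl ⟨h, h⟩)

theorem IsOddLevel.T_inv_mul_mem {P : Subgroup SL(2, ℤ)} (hP : IsOddLevel P) {γ : SL(2, ℤ)}
    (hγ : γ ∈ P) : ModularGroup.T⁻¹ * γ ∈ P :=
  mul_mem (inv_mem hP.T_mem) hγ

theorem index_heckeSubgroup {P P' : Subgroup SL(2, ℤ)} (h : ConjInto P P') (hP : IsOddLevel P) :
    (heckeSubgroup (imGL P) (imGL P') tMat).index = 2 := by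
  rw [Subgroup.index_eq_two_iff']
  refine ⟨⟨mapGL ℚ ModularGroup.T⁻¹, mapGL_mem_imGL.2 (inv_mem hP.T_mem)⟩, ?_⟩
  rintro ⟨_, γ, hγ, rfl⟩
  rw [mem_heckeSubgroup, mem_heckeSubgroup, Subgroup.coe_mul]
  change Xor (tMat * (mapGL ℚ ModularGroup.T⁻¹ * mapGL ℚ γ) * tMat⁻¹ ∈ _) _
  rw [← map_mul, h.mem_iff (hP.T_inv_mul_mem hγ), h.mem_iff hγ]
  exact hP.xor_even hγ

theorem finiteIndex_heckeSubgroup {P P' : Subgroup SL(2, ℤ)} (h : ConjInto P P')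
    (hP : IsOddLevel P) : (heckeSubgroup (imGL P) (imGL P') tMat).FiniteIndex :=
  ⟨by rw [index_heckeSubgroup h hP]; norm_num⟩

/-! ### Homology of subgroups of `SL₂(ℤ)` -/

/-- The map `ℤ₂ ⊗ A → ℤ₂ ⊗ B` induced by a homomorphism of commutative groups. -/
def tensorMap {A B : Type} [CommGroup A] [CommGroup B] (f : A →* B) :
    ℤ_[2] ⊗[ℤ] Additive A →ₗ[ℤ_[2]] ℤ_[2] ⊗[ℤ] Additive B :=
  (MonoidHom.toAdditive f).toIntLinearMap.baseChange ℤ_[2]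

theorem tensorMap_comp {A B C : Type} [CommGroup A] [CommGroup B] [CommGroup C] (g : B →* C)
    (f : A →* B) : tensorMap (g.comp f) = tensorMap g ∘ₗ tensorMap f := by
  refine LinearMap.ext fun x => ?_
  induction x using TensorProduct.induction_on with
  | zero => rw [map_zero, map_zero]
  | tmul z a => rfl
  | add x y hx hy => rw [map_add, map_add, hx, hy]

/-- `P^ab ⊗ ℤ₂`. -/
abbrev H1 (P : Subgroup SL(2, ℤ)) : Type := ℤ_[2] ⊗[ℤ] Additive (Abelianization (imGL P))

/-- The map `P^ab ⊗ ℤ₂ → P'^ab ⊗ ℤ₂` induced by an inclusion. -/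
def H1incl {P P' : Subgroup SL(2, ℤ)} (h : P ≤ P') : H1 P →ₗ[ℤ_[2]] H1 P' :=
  tensorMap (Abelianization.map (Subgroup.inclusion (Subgroup.map_mono h)))

/-- The Hecke operator `[t] : P^ab ⊗ ℤ₂ → P'^ab ⊗ ℤ₂`. -/
def H1hecke {P P' : Subgroup SL(2, ℤ)} (h : ConjInto P P') (hP : IsOddLevel P) :
    H1 P →ₗ[ℤ_[2]] H1 P' :=
  have := finiteIndex_heckeSubgroup h hP
  tensorMap (heckeOp (imGL P) (imGL P') tMat)

theorem H1incl_comp {P P' P'' : Subgroup SL(2, ℤ)} (h : P ≤ P') (h' : P' ≤ P'') :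
    H1incl h' ∘ₗ H1incl h = H1incl (h.trans h') := by
  rw [H1incl, H1incl, ← tensorMap_comp, Abelianization.map_comp]
  rfl

theorem H1incl_refl {P : Subgroup SL(2, ℤ)} (h : P ≤ P) : H1incl h = LinearMap.id := by
  have : Subgroup.inclusion (Subgroup.map_mono (f := mapGL ℚ) h) = MonoidHom.id _ := rfl
  rw [H1incl, this, Abelianization.map_id]
  exact LinearMap.baseChange_id

/-- The Hecke operators commute with the maps induced by inclusions. -/
theorem H1hecke_comp_H1incl {P P' Q Q' : Subgroup SL(2, ℤ)} (hP : IsOddLevel P) (hQ : IsOddLevel Q)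
    (h : P ≤ Q) (h' : P' ≤ Q') (hPP : ConjInto P P') (hQQ : ConjInto Q Q') :
    H1hecke hQQ hQ ∘ₗ H1incl h = H1incl h' ∘ₗ H1hecke hPP hP := by
  have := finiteIndex_heckeSubgroup hPP hP
  have := finiteIndex_heckeSubgroup hQQ hQ
  rw [H1hecke, H1hecke, H1incl, H1incl, ← tensorMap_comp, ← tensorMap_comp]
  congr 1
  refine heckeOp_comp_map _ _ ?_ ?_ ?_
  · rintro ⟨_, γ, hγ, rfl⟩
    exact (hPP.mem_iff hγ).trans (hQQ.mem_iff (h hγ)).symm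
  · rintro x y hxy
    exact hxy
  -- The coset representatives 1 and T of the larger group already lie in P.
  · rintro ⟨_, γ, hγ, rfl⟩
    rcases hQ.xor_even hγ with ⟨he, -⟩ | ⟨he, -⟩
    · refine ⟨⟨_, mapGL_mem_imGL.2 hP.T_mem⟩, ⟨_, mapGL_mem_imGL.2 (hQ.T_inv_mul_mem hγ)⟩,
        (hQQ.mem_iff (hQ.T_inv_mul_mem hγ)).2 he, Subtype.ext ?_⟩
      change mapGL ℚ γ = mapGL ℚ ModularGroup.T * mapGL ℚ (ModularGroup.T⁻¹ * γ)
      rw [← map_mul, mul_inv_cancel_left]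
    · exact ⟨1, ⟨_, mapGL_mem_imGL.2 hγ⟩, (hQQ.mem_iff hγ).2 he, by rw [map_one, one_mul]⟩

/-- SL₂(ℤ) is finitely generated, hence so are its subgroups of finite index. -/
theorem finite_H1 (P : Subgroup SL(2, ℤ)) [P.FiniteIndex] : Module.Finite ℤ_[2] (H1 P) := by
  have h1 : Group.FG SL(2, ℤ) := ⟨{ModularGroup.S, ModularGroup.T}, by
    simpa using SpecialLinearGroup.SL2Z_generators⟩
  have h2 : Group.FG P := Subgroup.fg_of_index_ne_zero P
  have h3 : Group.FG (imGL P) := Group.fg_of_surjective ((mapGL ℚ).subgroupMap_surjective P)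
  have h4 : Group.FG (Abelianization (imGL P)) :=
    Group.fg_of_surjective (f := Abelianization.of) (QuotientGroup.mk'_surjective _)
  have h5 : Module.Finite ℤ (Additive (Abelianization (imGL P))) :=
    Module.Finite.iff_addGroup_fg.2 inferInstance
  infer_instance

/-! ### Congruence subgroups -/

theorem mem_Gamma1_of_mem_Gamma0 {M : ℕ} {γ : SL(2, ℤ)} (h0 : γ ∈ Gamma0 M)
    (h1 : ((γ 1 1 : ℤ) : ZMod M) = 1) : γ ∈ Gamma1 M := by
  have : (⟨γ, h0⟩ : Gamma0 M) ∈ Gamma1' M := by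
    rw [Gamma1_mem']
    exact h1
  exact ⟨⟨_, this⟩, trivial, rfl⟩

theorem apply_eq_one_of_mem_Gamma1 {M : ℕ} {γ : SL(2, ℤ)} (h : γ ∈ Gamma1 M) :
    ((γ 1 1 : ℤ) : ZMod M) = 1 :=
  ((Gamma1_mem M γ).1 h).2.1

theorem mul_inv_mem_Gamma1 {M : ℕ} {σ τ : SL(2, ℤ)} (hσ : σ ∈ Gamma0 M) (hτ : τ ∈ Gamma0 M)
    (h : ((σ 1 1 : ℤ) : ZMod M) = (τ 1 1 : ℤ)) : σ * τ⁻¹ ∈ Gamma1 M := by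
  refine mem_Gamma1_of_mem_Gamma0 (mul_mem hσ (inv_mem hτ)) ?_
  have h1 : Gamma0Map M (⟨σ, hσ⟩ * (⟨τ, hτ⟩ : Gamma0 M)⁻¹) = 1 := by
    have h2 : Gamma0Map M ⟨σ, hσ⟩ = Gamma0Map M ⟨τ, hτ⟩ := h
    rw [map_mul, h2, ← map_mul, mul_inv_cancel, map_one]
  exact h1

theorem intCast_eq_of_dvd {M M' : ℕ} (h : M' ∣ M) {a b : ℤ} (hab : (a : ZMod M) = b) :
    (a : ZMod M') = b := by
  simpa only [map_intCast] using congrArg (ZMod.castHom h (ZMod M')) hab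

theorem intCast_eq_of_coprime {M M' : ℕ} (h : Nat.Coprime M M') {a b : ℤ}
    (h1 : (a : ZMod M) = b) (h2 : (a : ZMod M') = b) : (a : ZMod (M * M')) = b := by
  rw [ZMod.intCast_eq_intCast_iff_dvd_sub] at h1 h2 ⊢
  rw [Nat.cast_mul]
  exact IsCoprime.mul_dvd (Nat.isCoprime_iff_coprime.2 h) h1 h2

theorem Gamma0_le_of_dvd {M M' : ℕ} (h : M' ∣ M) : Gamma0 M ≤ Gamma0 M' := by
  intro γ hγ
  rw [Gamma0_mem] at hγ ⊢
  simpa using intCast_eq_of_dvd h (b := 0) (by simpa using hγ)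

theorem Gamma1_le_of_dvd {M M' : ℕ} (h : M' ∣ M) : Gamma1 M ≤ Gamma1 M' := fun γ hγ =>
  mem_Gamma1_of_mem_Gamma0 (Gamma0_le_of_dvd h (Gamma1_in_Gamma0 _ hγ))
    (by simpa using intCast_eq_of_dvd h (b := 1) (by simpa using apply_eq_one_of_mem_Gamma1 hγ))

theorem conjInto_Gamma1 (M : ℕ) : ConjInto (Gamma1 M) (Gamma1 M) := by
  intro γ hγ δ h1 h2 h3
  rw [Gamma1_mem] at hγ ⊢
  rw [h1, h2, h3]
  exact ⟨hγ.1, hγ.2.1, by rw [Int.cast_mul, hγ.2.2, mul_zero]⟩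

theorem T_mem_Gamma1 (M : ℕ) : ModularGroup.T ∈ Gamma1 M := by
  rw [Gamma1_mem]
  simp [ModularGroup.coe_T]

theorem isOddLevel_of_le {M : ℕ} (hM : 2 ∣ M) {P : Subgroup SL(2, ℤ)} (hP : P ≤ Gamma1 M)
    (hT : ModularGroup.T ∈ P) : IsOddLevel P where
  T_mem := hT
  odd_apply γ hγ := by
    have := intCast_eq_of_dvd hM (a := γ 1 1) (b := 1)
      (by simpa using apply_eq_one_of_mem_Gamma1 (hP hγ))
    rw [← ZMod.intCast_eq_one_iff_odd]
    simpa using this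

theorem isOddLevel_Gamma1 {M : ℕ} (hM : 2 ∣ M) : IsOddLevel (Gamma1 M) :=
  isOddLevel_of_le hM le_rfl (T_mem_Gamma1 M)

/-- The group `Γ₁(M) ∩ Γ₀(2^i)`. -/
def midGroup (M i : ℕ) : Subgroup SL(2, ℤ) := Gamma1 M ⊓ Gamma0 (2 ^ i)

theorem midGroup_le (M i : ℕ) : midGroup M i ≤ Gamma1 M := inf_le_left

theorem midGroup_succ_le (M i : ℕ) : midGroup M (i + 1) ≤ midGroup M i :=
  inf_le_inf_left _ (Gamma0_le_of_dvd (pow_dvd_pow 2 i.le_succ))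

theorem le_midGroup {M i : ℕ} (h : 2 ^ i ∣ M) : Gamma1 M ≤ midGroup M i :=
  le_inf le_rfl ((Gamma1_in_Gamma0 M).trans (Gamma0_le_of_dvd h))

theorem isOddLevel_midGroup {M : ℕ} (hM : 2 ∣ M) (i : ℕ) : IsOddLevel (midGroup M i) :=
  isOddLevel_of_le hM (midGroup_le M i) ⟨T_mem_Gamma1 M, by
    simp [ModularGroup.coe_T]⟩

/-- Conjugation by t doubles the lower left entry; this is what raises the level at 2. -/
theorem conjInto_midGroup_succ (M i : ℕ) : ConjInto (midGroup M i) (midGroup M (i + 1)) := by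
  rintro γ ⟨hγ, hγ'⟩ δ h1 h2 h3
  refine ⟨conjInto_Gamma1 M γ hγ δ h1 h2 h3, ?_⟩
  change δ ∈ Gamma0 _
  change γ ∈ Gamma0 _ at hγ'
  rw [Gamma0_mem, ZMod.intCast_zmod_eq_zero_iff_dvd] at hγ' ⊢
  rw [h2]
  push_cast at hγ' ⊢
  rw [pow_succ']
  exact mul_dvd_mul_left 2 hγ'

theorem conjInto_midGroup (M i : ℕ) : ConjInto (midGroup M i) (midGroup M i) :=
  fun γ hγ δ h1 h2 h3 => midGroup_succ_le M i (conjInto_midGroup_succ M i γ hγ δ h1 h2 h3)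

/-! ### Comparison of `Γ₁(M)` with `Γ₁(M) ∩ Γ₀(2^i)` -/

section Mid

variable {M : ℕ} (hM : 2 ∣ M) (i : ℕ)

/-- The Hecke operator `U` on the homology of `Γ₁(M) ∩ Γ₀(2^i)`. -/
abbrev midU : Module.End ℤ_[2] (H1 (midGroup M i)) :=
  H1hecke (conjInto_midGroup M i) (isOddLevel_midGroup hM i)

/-- The Hecke operator `U` on the homology of `Γ₁(M)`. -/
abbrev gammaU : Module.End ℤ_[2] (H1 (Gamma1 M)) :=
  H1hecke (conjInto_Gamma1 M) (isOddLevel_Gamma1 hM)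

theorem H1incl_comp_midU : H1incl (midGroup_le M i) ∘ₗ midU hM i =
    gammaU hM ∘ₗ H1incl (midGroup_le M i) :=
  (H1hecke_comp_H1incl (isOddLevel_midGroup hM i) (isOddLevel_Gamma1 hM) _ _ _ _).symm

/-- The powers of `U` on the homology of `Γ₁(M)` and of `Γ₁(M) ∩ Γ₀(2^(i+j))` factor through each
other when `2^i ∣ M`. -/
theorem exists_factor_pow {i : ℕ} (hi : 2 ^ i ∣ M) (j : ℕ) :
    ∃ θ : H1 (Gamma1 M) →ₗ[ℤ_[2]] H1 (midGroup M (i + j)),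
      H1incl (midGroup_le M (i + j)) ∘ₗ θ = gammaU hM ^ j ∧
      θ ∘ₗ H1incl (midGroup_le M (i + j)) = midU hM (i + j) ^ j := by
  induction j with
  | zero =>
    -- For j = 0 the two groups coincide, because 2^i divides M.
    refine ⟨H1incl (le_midGroup hi), ?_, ?_⟩
    · rw [H1incl_comp, H1incl_refl]; rfl
    · rw [H1incl_comp, H1incl_refl]; rfl
  | succ j ih =>
    obtain ⟨θ, h1, h2⟩ := ih
    -- V is the Hecke operator of t with target one level higher. Composed with the inclusion ι it
    -- gives U at the lower level (ι V) and at the higher one (V ι).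
    let V := H1hecke (conjInto_midGroup_succ M (i + j)) (isOddLevel_midGroup hM (i + j))
    let ι := H1incl (midGroup_succ_le M (i + j))
    have hιV : ι ∘ₗ V = midU hM (i + j) := by
      have := H1hecke_comp_H1incl (isOddLevel_midGroup hM (i + j)) (isOddLevel_midGroup hM (i + j))
        le_rfl (midGroup_succ_le M (i + j)) (conjInto_midGroup_succ M (i + j))
        (conjInto_midGroup M (i + j))
      rw [H1incl_refl, LinearMap.comp_id] at this
      exact this.symm
    have hVι : V ∘ₗ ι = midU hM (i + j + 1) := by
      have := H1hecke_comp_H1incl (isOddLevel_midGroup hM (i + j + 1))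
        (isOddLevel_midGroup hM (i + j)) (midGroup_succ_le M (i + j)) le_rfl
        (conjInto_midGroup M (i + j + 1)) (conjInto_midGroup_succ M (i + j))
      rw [H1incl_refl, LinearMap.id_comp] at this
      exact this
    have hVU : ∀ n : ℕ, V ∘ₗ (midU hM (i + j) ^ n) = (midU hM (i + j + 1) ^ n) ∘ₗ V := by
      intro n
      induction n with
      | zero => rfl
      | succ n ih =>
        rw [pow_succ, pow_succ, Module.End.mul_eq_comp, Module.End.mul_eq_comp,
          ← LinearMap.comp_assoc, ih, LinearMap.comp_assoc, LinearMap.comp_assoc, ← hιV, ← hVι,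
          LinearMap.comp_assoc]
    have hι : H1incl (midGroup_le M (i + (j + 1))) = H1incl (midGroup_le M (i + j)) ∘ₗ ι :=
      (H1incl_comp _ _).symm
    refine ⟨V ∘ₗ θ, ?_, ?_⟩
    · rw [hι, LinearMap.comp_assoc, ← LinearMap.comp_assoc θ V ι, hιV, ← LinearMap.comp_assoc,
        H1incl_comp_midU, LinearMap.comp_assoc, h1, pow_succ', Module.End.mul_eq_comp]
    · rw [hι, LinearMap.comp_assoc, ← LinearMap.comp_assoc ι _ θ, h2, ← LinearMap.comp_assoc, hVU,
        LinearMap.comp_assoc, hVι]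
      exact (pow_succ _ _).symm

/-! ### Comparison of `Γ₁(M 2^(i-s))` with `Γ₁(M) ∩ Γ₀(2^i)` -/

/-- The character of `Γ₁(M) ∩ Γ₀(2^i)` given by the lower right entry modulo `2^i`. -/
def midChar (M i : ℕ) : midGroup M i →* (ZMod (2 ^ i))ˣ :=
  ((Gamma0Map (2 ^ i)).comp (Subgroup.inclusion inf_le_right)).toHomUnits

theorem coe_midChar {M i : ℕ} (γ : midGroup M i) :
    (midChar M i γ : ZMod (2 ^ i)) = ((γ : SL(2, ℤ)) 1 1 : ℤ) := rfl

/-- The character `midChar`, on the image of the group in `GL₂(ℚ)`. -/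
def midCharGL (M i : ℕ) : imGL (midGroup M i) →* (ZMod (2 ^ i))ˣ :=
  (midChar M i).comp ((midGroup M i).equivMapOfInjective (mapGL ℚ) mapGL_injective).symm

theorem midCharGL_mapGL {M i : ℕ} (γ : SL(2, ℤ)) (hγ : γ ∈ midGroup M i)
    (h : mapGL ℚ γ ∈ imGL (midGroup M i)) :
    midCharGL M i ⟨mapGL ℚ γ, h⟩ = midChar M i ⟨γ, hγ⟩ := by
  rw [midCharGL, MonoidHom.comp_apply]
  congr 1
  exact (MulEquiv.symm_apply_eq _).2 rfl

include hM in
-- Conjugation by t fixes the lower right entry, so U raises the character to the power of the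
-- index, which is 2.
theorem lift_midCharGL_heckeOp
    [(heckeSubgroup (imGL (midGroup M i)) (imGL (midGroup M i)) tMat).FiniteIndex]
    (x : Abelianization (imGL (midGroup M i))) :
    Abelianization.lift (midCharGL M i)
        (heckeOp (imGL (midGroup M i)) (imGL (midGroup M i)) tMat x) =
      Abelianization.lift (midCharGL M i) x ^ 2 := by
  rw [lift_heckeOp, index_heckeSubgroup (conjInto_midGroup M i) (isOddLevel_midGroup hM i)]
  rintro ⟨_, γ, hγ, rfl⟩ ⟨_, δ, hδ, rfl⟩ h
  refine (midCharGL_mapGL δ hδ _).trans (Eq.trans ?_ (midCharGL_mapGL γ hγ _).symm)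
  ext
  rw [coe_midChar, coe_midChar, ((tMat_conj_eq_iff γ δ).1 h.symm).2.2.2]

end Mid

theorem tensorMap_pow_tmul {A : Type} [CommGroup A] (f : A →* A) (n : ℕ) (z : ℤ_[2]) (a : A) :
    ((tensorMap f : Module.End ℤ_[2] (ℤ_[2] ⊗[ℤ] Additive A)) ^ n) (z ⊗ₜ Additive.ofMul a) =
      z ⊗ₜ Additive.ofMul (f^[n] a) := by
  induction n with
  | zero => rfl
  | succ n ih => rw [pow_succ', Module.End.mul_apply, ih, Function.iterate_succ_apply']; rfl

/-- A power of `U` takes the homology of `Γ₁(M) ∩ Γ₀(2^i)` into the image of the homology of the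
kernel of the lower right entry modulo `2^i`. -/
theorem midU_pow_mem_range {M : ℕ} (hM : 2 ∣ M) {i : ℕ} (hi : i ≠ 0) {P : Subgroup SL(2, ℤ)}
    (h : P ≤ midGroup M i)
    (hker : ∀ γ ∈ midGroup M i, ((γ 1 1 : ℤ) : ZMod (2 ^ i)) = 1 → γ ∈ P)
    (x : H1 (midGroup M i)) : (midU hM i ^ i) x ∈ LinearMap.range (H1incl h) := by
  have := finiteIndex_heckeSubgroup (conjInto_midGroup M i) (isOddLevel_midGroup hM i)
  induction x using TensorProduct.induction_on with
  | zero => rw [map_zero]; exact zero_mem _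
  | add x y hx hy => rw [map_add]; exact add_mem hx hy
  | tmul z a =>
    let W := heckeOp (imGL (midGroup M i)) (imGL (midGroup M i)) tMat
    have hlift : ∀ n : ℕ, Abelianization.lift (midCharGL M i) (W^[n] a.toMul) =
        Abelianization.lift (midCharGL M i) a.toMul ^ 2 ^ n := by
      intro n
      induction n with
      | zero => simp
      | succ n ih =>
        rw [Function.iterate_succ_apply', lift_midCharGL_heckeOp hM, ih, pow_succ 2 n, pow_mul]
    -- The unit group has order 2^(i-1), so i applications of U, giving the 2^i-th power, more than
    -- suffice.
    have hone : ∀ u : (ZMod (2 ^ i))ˣ, u ^ 2 ^ i = 1 := by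
      intro u
      obtain ⟨k, rfl⟩ := Nat.exists_eq_add_one_of_ne_zero hi
      have := ZMod.pow_totient u
      rw [Nat.totient_prime_pow_succ Nat.prime_two, Nat.add_one_sub_one, mul_one] at this
      exact orderOf_dvd_iff_pow_eq_one.1
        ((orderOf_dvd_of_pow_eq_one this).trans (pow_dvd_pow 2 k.le_succ))
    -- The character is defined on the abelianization, so any representative γ of the class has
    -- trivial character and lies in P.
    obtain ⟨⟨_, γ, hγ, rfl⟩, hb⟩ : ∃ b, Abelianization.of b = W^[i] a.toMul :=
      QuotientGroup.mk'_surjective _ _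
    have hb' := hlift i
    rw [hone, ← hb, Abelianization.lift_apply_of] at hb'
    replace hb' := (midCharGL_mapGL γ hγ _).symm.trans hb'
    have hP : γ ∈ P := hker γ hγ (by rw [← coe_midChar ⟨γ, hγ⟩, hb', Units.val_one])
    refine ⟨z ⊗ₜ Additive.ofMul (Abelianization.of ⟨mapGL ℚ γ, mapGL_mem_imGL.2 hP⟩), ?_⟩
    refine Eq.trans ?_ (tensorMap_pow_tmul W i z a.toMul).symm
    rw [← hb]
    rfl

/-- If `Q / P` is generated by the class of `g`, the kernel of `P^ab ⊗ ℤ₂ → Q^ab ⊗ ℤ₂` is the image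
of `c - 1`, for `c` the conjugation by `g`. -/
theorem exists_sub_eq_of_H1incl_eq_zero {P Q : Subgroup SL(2, ℤ)} (h : P ≤ Q) {g : SL(2, ℤ)}
    (hgQ : g ∈ Q) (hg : mapGL ℚ g ∈ Subgroup.normalizer (imGL P : Set (GL (Fin 2) ℚ)))
    (hgen : ∀ x ∈ Q, ∃ n : ℤ, ∃ y ∈ P, x = g ^ n * y) (c : imGL P →* imGL P)
    (hc : ∀ x, (c x : GL (Fin 2) ℚ) = mapGL ℚ g * x * (mapGL ℚ g)⁻¹) (x : H1 P)
    (hx : H1incl h x = 0) : ∃ y, tensorMap (Abelianization.map c) y - y = x := by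
  have hgen' : ∀ x ∈ imGL Q, ∃ n : ℤ, ∃ y ∈ imGL P, x = mapGL ℚ g ^ n * y := by
    rintro _ ⟨x, hx, rfl⟩
    obtain ⟨n, y, hy, rfl⟩ := hgen x hx
    exact ⟨n, mapGL ℚ y, mapGL_mem_imGL.2 hy, by rw [map_mul, map_zpow]⟩
  have hle : imGL P ≤ imGL Q := Subgroup.map_mono h
  let f := (MonoidHom.toAdditive (Abelianization.map c)).toIntLinearMap - LinearMap.id
  let ι := (MonoidHom.toAdditive (Abelianization.map (Subgroup.inclusion hle))).toIntLinearMap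
  have hexact : Function.Exact f ι := by
    intro a
    constructor
    · intro ha
      exact exists_eq_map_div_self hle hg hgen' c hc a.toMul ha
    · rintro ⟨a, rfl⟩
      obtain ⟨b, rfl⟩ : ∃ b, Additive.ofMul (Abelianization.of b) = a :=
        QuotientGroup.mk'_surjective _ _
      have h1 : Subgroup.inclusion hle (c b) =
          ⟨mapGL ℚ g, mapGL_mem_imGL.2 hgQ⟩ * Subgroup.inclusion hle b *
            ⟨mapGL ℚ g, mapGL_mem_imGL.2 hgQ⟩⁻¹ := Subtype.ext (hc b)
      have h2 : Abelianization.map (Subgroup.inclusion hle)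
          (Abelianization.map c (Abelianization.of b) / Abelianization.of b) = 1 := by
        rw [map_div, Abelianization.map_of, Abelianization.map_of, Abelianization.map_of, h1,
          map_mul, map_mul, map_inv, mul_comm (Abelianization.of _), mul_inv_cancel_right, div_self']
      exact h2
  -- Exactness over ℤ survives the tensor product because ℤ₂ is flat.
  obtain ⟨y, hy⟩ := (Module.Flat.lTensor_exact ℤ_[2] hexact x).1 hx
  refine ⟨y, ?_⟩
  rw [← hy, LinearMap.lTensor_sub, LinearMap.sub_apply, LinearMap.lTensor_id]
  rfl

/-! ### Cyclicity -/

/-- The kernel has 2^n elements, and 5 lies in it and has order 2^n. -/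
theorem isCyclic_ker_unitsMap (n : ℕ) :
    IsCyclic (ZMod.unitsMap (pow_dvd_pow 2 (Nat.le_add_left 2 n)) :
      (ZMod (2 ^ (n + 2)))ˣ →* (ZMod (2 ^ 2))ˣ).ker := by
  set f := (ZMod.unitsMap (pow_dvd_pow 2 (Nat.le_add_left 2 n)) :
      (ZMod (2 ^ (n + 2)))ˣ →* (ZMod (2 ^ 2))ˣ)
  have hcard : Nat.card f.ker = 2 ^ n := by
    have h1 := f.ker.card_mul_index
    have hsurj : Function.Surjective f := ZMod.unitsMap_surjective _
    rw [Subgroup.index_ker, MonoidHom.range_eq_top.2 hsurj, Subgroup.card_top,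
      Nat.card_eq_fintype_card (α := (ZMod (2 ^ 2))ˣ), ZMod.card_units_eq_totient,
      Nat.card_eq_fintype_card (α := (ZMod (2 ^ (n + 2)))ˣ), ZMod.card_units_eq_totient,
      Nat.totient_prime_pow_succ Nat.prime_two, Nat.totient_prime_pow_succ Nat.prime_two] at h1
    have : (2 : ℕ) ^ (n + 1) = 2 ^ n * 2 := pow_succ 2 n
    omega
  have h5 : IsUnit (5 : ZMod (2 ^ (n + 2))) := by
    have : IsUnit ((5 : ℕ) : ZMod (2 ^ (n + 2))) :=
      (ZMod.isUnit_iff_coprime _ _).2 (Nat.Coprime.pow_right _ (by norm_num))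
    exact_mod_cast this
  have hmem : h5.unit ∈ f.ker := by
    rw [MonoidHom.mem_ker]
    ext
    rw [ZMod.unitsMap_val]
    change ((5 : ZMod (2 ^ (n + 2))).cast : ZMod (2 ^ 2)) = 1
    have h := map_ofNat (ZMod.castHom (pow_dvd_pow 2 (Nat.le_add_left 2 n)) (ZMod (2 ^ 2))) 5
    rw [ZMod.castHom_apply] at h
    rw [h]
    rfl
  refine isCyclic_of_orderOf_eq_card (⟨h5.unit, hmem⟩ : f.ker) ?_
  rw [hcard, Subgroup.orderOf_mk, ← orderOf_units, IsUnit.unit_spec, ZMod.orderOf_five]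

/-- If `4 ∣ M`, the quotient of `Γ₁(M) ∩ Γ₀(2^i)` by the kernel of the lower right entry modulo
`2^i` is cyclic. -/
theorem exists_generator {M i : ℕ} (hM : 4 ∣ M) (hi : 2 ≤ i) : ∃ g ∈ midGroup M i,
    ∀ x ∈ midGroup M i, ∃ n : ℤ, ∃ y ∈ midGroup M i,
      ((y 1 1 : ℤ) : ZMod (2 ^ i)) = 1 ∧ x = g ^ n * y := by
  obtain ⟨n, rfl⟩ := Nat.exists_eq_add_of_le' hi
  have := isCyclic_ker_unitsMap n
  have hle : (midChar M (n + 2)).range ≤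
      (ZMod.unitsMap (pow_dvd_pow 2 (Nat.le_add_left 2 n))).ker := by
    rintro _ ⟨γ, rfl⟩
    rw [MonoidHom.mem_ker]
    ext
    rw [ZMod.unitsMap_val, coe_midChar, ZMod.cast_intCast (pow_dvd_pow 2 (Nat.le_add_left 2 n))]
    simpa using intCast_eq_of_dvd (M' := 2 ^ 2) (by simpa using hM) (b := 1)
      (by simpa using apply_eq_one_of_mem_Gamma1 γ.2.1)
  have : IsCyclic (midChar M (n + 2)).range := Subgroup.isCyclic_of_le hle
  obtain ⟨⟨_, g, rfl⟩, hg⟩ := IsCyclic.exists_zpow_surjective (G := (midChar M (n + 2)).range)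
  refine ⟨g, g.2, fun x hx => ?_⟩
  obtain ⟨k, hk⟩ := hg ⟨_, ⟨x, hx⟩, rfl⟩
  have hk' : midChar M (n + 2) g ^ k = midChar M (n + 2) ⟨x, hx⟩ := congrArg Subtype.val hk
  refine ⟨k, ((g ^ k)⁻¹ * ⟨x, hx⟩ : midGroup M (n + 2)), SetLike.coe_mem _, ?_, ?_⟩
  · rw [← coe_midChar, map_mul, map_inv, map_zpow, hk', inv_mul_cancel, Units.val_one]
  · simp

/-! ### The nebentypus action -/

theorem conj_mem_G1_iff {M : ℕ} {σ : SL(2, ℤ)} (hσ : σ ∈ Gamma0 M) {x : GL (Fin 2) ℚ} :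
    mapGL ℚ σ * x * (mapGL ℚ σ)⁻¹ ∈ G1 M ↔ x ∈ G1 M := by
  refine ⟨fun h => ?_, fun h => conj_mem_G1 ⟨σ, hσ⟩ h⟩
  have h' := conj_mem_G1 ⟨σ⁻¹, inv_mem hσ⟩ h
  have hx : mapGL ℚ σ⁻¹ * (mapGL ℚ σ * x * (mapGL ℚ σ)⁻¹) * (mapGL ℚ σ⁻¹)⁻¹ = x := by
    rw [map_inv]
    group
  rwa [hx] at h'

section Nebentypus

variable {N r : ℕ} (hN : Nat.Coprime 2 N)

theorem conjG1_apply (σ : Phi N r) (x : G1 (N * 2 ^ r)) :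
    (conjG1 hN σ x : GL (Fin 2) ℚ) =
      mapGL ℚ (σ : SL(2, ℤ)) * x * (mapGL ℚ (σ : SL(2, ℤ)))⁻¹ := rfl

theorem conjG1_surjective (σ : Phi N r) : Function.Surjective (conjG1 hN σ) := by
  intro y
  have hy : mapGL ℚ (σ : SL(2, ℤ)) * ((mapGL ℚ (σ : SL(2, ℤ)))⁻¹ * y * mapGL ℚ (σ : SL(2, ℤ))) *
      (mapGL ℚ (σ : SL(2, ℤ)))⁻¹ = y := by
    simp only [mul_assoc, mul_inv_cancel_left, mul_inv_cancel, mul_one]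
  refine ⟨⟨_, (conj_mem_G1_iff (Phi_le hN r σ.2)).1 (by rw [hy]; exact y.2)⟩, Subtype.ext ?_⟩
  rw [conjG1_apply, hy]

/-- Conjugation by elements of a group acts trivially on its abelianization. -/
theorem abelianization_of_eq_of_conj {T : Type*} [Group T] {G : Subgroup T} {x y : G} {g : T}
    (hg : g ∈ G) (h : (y : T) = g * x * g⁻¹) : Abelianization.of y = Abelianization.of x := by
  have : y = ⟨g, hg⟩ * x * ⟨g, hg⟩⁻¹ := Subtype.ext h
  rw [this, map_mul, map_mul, map_inv, mul_comm (Abelianization.of _), mul_inv_cancel_right]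

/-- The action of `σ` only depends on its lower right entry. -/
theorem map_conjG1_congr {σ τ : Phi N r}
    (h : (((σ : SL(2, ℤ)) 1 1 : ℤ) : ZMod (N * 2 ^ r)) = ((τ : SL(2, ℤ)) 1 1 : ℤ)) :
    Abelianization.map (conjG1 hN σ) = Abelianization.map (conjG1 hN τ) := by
  refine Abelianization.hom_ext _ _ (MonoidHom.ext fun x => ?_)
  simp only [MonoidHom.comp_apply, Abelianization.map_of]
  refine abelianization_of_eq_of_conj
    (mapGL_mem_imGL.2 (mul_inv_mem_Gamma1 (Phi_le hN r σ.2) (Phi_le hN r τ.2) h)) ?_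
  rw [conjG1_apply, conjG1_apply, map_mul, map_inv]
  group

/-- Left multiplication by T⁻¹ keeps the lower row, so the action can be represented by a matrix
whose conjugate by t is integral. -/
theorem exists_even_of_mem_Phi (σ : Phi N r) : ∃ τ : Phi N r,
    (τ : SL(2, ℤ)) 1 1 = (σ : SL(2, ℤ)) 1 1 ∧ Even ((τ : SL(2, ℤ)) 0 1) := by
  have h4 : 2 ∣ N * 4 := Dvd.dvd.mul_left (by norm_num) N
  have hodd : IsOddLevel (Phi N r) := isOddLevel_midGroup h4 r
  rcases hodd.xor_even σ.2 with ⟨h, -⟩ | ⟨h, -⟩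
  · exact ⟨⟨_, hodd.T_inv_mul_mem σ.2⟩, T_inv_mul_apply_one _ _, h⟩
  · exact ⟨σ, rfl, h⟩

/-- Choose σ' with the lower right entry of σ such that τ = tσ't⁻¹ is integral. Moving conjugation
by σ' across the Hecke operator turns it into conjugation by τ, which acts in the same way because
the lower right entry is unchanged. -/
theorem heckeOp_comp_map_conjG1 (hr : r ≠ 0) (σ : Phi N r) :
    (heckeOp (G1 (N * 2 ^ r)) (G1 (N * 2 ^ r)) tMat).comp (Abelianization.map (conjG1 hN σ)) =
      (Abelianization.map (conjG1 hN σ)).comp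
        (heckeOp (G1 (N * 2 ^ r)) (G1 (N * 2 ^ r)) tMat) := by
  obtain ⟨σ', h11, heven⟩ := exists_even_of_mem_Phi σ
  have hodd : IsOddLevel (Gamma1 (N * 2 ^ r)) :=
    isOddLevel_Gamma1 (Dvd.dvd.mul_left (dvd_pow_self 2 hr) N)
  have hinto := conjInto_Gamma1 (N * 2 ^ r)
  obtain ⟨τ, hτ⟩ := exists_tMat_conj_eq heven
  obtain ⟨h1, h2, h3, h4⟩ := (tMat_conj_eq_iff _ _).1 hτ
  have hτΦ : τ ∈ Phi N r := conjInto_midGroup (N * 4) r σ' σ'.2 τ h1 h3 h4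
  have hmap : Abelianization.map (conjG1 hN σ') = Abelianization.map (conjG1 hN σ) :=
    map_conjG1_congr hN (by rw [h11])
  have hmap' : Abelianization.map (conjG1 hN ⟨τ, hτΦ⟩) = Abelianization.map (conjG1 hN σ) :=
    map_conjG1_congr hN (by rw [← h11, ← h4])
  have hσt : ∀ x : GL (Fin 2) ℚ, tMat * (mapGL ℚ (σ' : SL(2, ℤ)) * x *
      (mapGL ℚ (σ' : SL(2, ℤ)))⁻¹) * tMat⁻¹ =
      mapGL ℚ τ * (tMat * x * tMat⁻¹) * (mapGL ℚ τ)⁻¹ := by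
    intro x
    rw [← hτ]
    group
  nth_rw 1 [← hmap]
  rw [← hmap']
  refine heckeOp_comp_map _ _ ?_ ?_ ?_
  · intro x
    rw [conjG1_apply, hσt]
    exact (conj_mem_G1_iff (Phi_le hN r hτΦ)).symm
  · intro x y hxy
    rw [conjG1_apply, conjG1_apply, hσt, hxy]
  · intro x
    have hmem := conjG1_surjective hN σ'
    obtain ⟨_, γ, hγ, rfl⟩ := x
    rcases hodd.xor_even hγ with ⟨he, -⟩ | ⟨he, -⟩
    · obtain ⟨k, hk⟩ := hmem ⟨_, mapGL_mem_imGL.2 hodd.T_mem⟩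
      refine ⟨k, ⟨_, mapGL_mem_imGL.2 (hodd.T_inv_mul_mem hγ)⟩,
        (hinto.mem_iff (hodd.T_inv_mul_mem hγ)).2 he, ?_⟩
      rw [hk]
      refine Subtype.ext ?_
      change mapGL ℚ γ = mapGL ℚ ModularGroup.T * mapGL ℚ (ModularGroup.T⁻¹ * γ)
      rw [← map_mul, mul_inv_cancel_left]
    · exact ⟨1, ⟨_, mapGL_mem_imGL.2 hγ⟩, (hinto.mem_iff hγ).2 he, by rw [map_one, one_mul]⟩

theorem conjAct_commute (hr : r ≠ 0) (σ : Phi N r) :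
    Commute (conjAct hN σ) (atkinU (N * 2 ^ r)) := by
  have h := congrArg tensorMap (heckeOp_comp_map_conjG1 hN hr σ)
  rw [tensorMap_comp, tensorMap_comp] at h
  exact h.symm

/-- Such a σ lies in Γ₁(N2^s), so its conjugation is inner at level N2^s. -/
theorem levelMap_conjAct {s : ℕ} (hsr : s ≤ r) {σ : Phi N r}
    (h : (((σ : SL(2, ℤ)) 1 1 : ℤ) : ZMod (2 ^ s)) = 1) (m : Homology (N * 2 ^ r)) :
    levelMap (mul_dvd_mul_left N (pow_dvd_pow 2 hsr)) (conjAct hN σ m) =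
      levelMap (mul_dvd_mul_left N (pow_dvd_pow 2 hsr)) m := by
  have hdvd : N * 2 ^ s ∣ N * 2 ^ r := mul_dvd_mul_left N (pow_dvd_pow 2 hsr)
  have hmem : (σ : SL(2, ℤ)) ∈ Gamma1 (N * 2 ^ s) := by
    refine mem_Gamma1_of_mem_Gamma0 (Gamma0_le_of_dvd hdvd (Phi_le hN r σ.2)) ?_
    have h1 := intCast_eq_of_dvd (M' := N) (dvd_mul_right N 4) (b := 1)
      (by simpa using apply_eq_one_of_mem_Gamma1 σ.2.1)
    simpa using intCast_eq_of_coprime (hN.symm.pow_right s) h1 (by simpa using h)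
  have hmap : (Abelianization.map (Subgroup.inclusion (G1_le_of_dvd hdvd))).comp
      (Abelianization.map (conjG1 hN σ)) =
      Abelianization.map (Subgroup.inclusion (G1_le_of_dvd hdvd)) := by
    refine Abelianization.hom_ext _ _ (MonoidHom.ext fun x => ?_)
    simp only [MonoidHom.comp_apply, Abelianization.map_of]
    exact abelianization_of_eq_of_conj (mapGL_mem_imGL.2 hmem) (conjG1_apply hN σ x)
  have h5 := congrArg tensorMap hmap
  rw [tensorMap_comp] at h5
  exact LinearMap.congr_fun h5 m

end Nebentypus

theorem apply_eq_one_of_isLift {N r s : ℕ} (hsr : s ≤ r) {σ : Phi N r} {γ : ℤ_[2]ˣ}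
    (h : IsLift σ γ) (hγ : γ ∈ Gam s) : (((σ : SL(2, ℤ)) 1 1 : ℤ) : ZMod (2 ^ s)) = 1 := by
  have h1 : PadicInt.toZModPow (p := 2) s (γ : ℤ_[2]) = 1 := congrArg Units.val hγ
  have h2 := congrArg (ZMod.castHom (pow_dvd_pow 2 hsr) (ZMod (2 ^ s))) h
  rw [map_intCast, ZMod.castHom_apply, PadicInt.cast_toZModPow _ _ hsr, h1] at h2
  exact h2

/-- For γ one takes the lower right entry itself: an odd integer, hence a 2-adic unit. -/
theorem exists_isLift {N r s : ℕ} (σ : Phi N r)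
    (hσ : (((σ : SL(2, ℤ)) 1 1 : ℤ) : ZMod (2 ^ s)) = 1) : ∃ γ ∈ Gam s, IsLift σ γ := by
  have hodd : Odd ((σ : SL(2, ℤ)) 1 1) :=
    (isOddLevel_midGroup (Dvd.dvd.mul_left (by norm_num) N) r : IsOddLevel (Phi N r)).odd_apply _ σ.2
  have hu : IsUnit ((((σ : SL(2, ℤ)) 1 1 : ℤ)) : ℤ_[2]) := by
    rw [PadicInt.isUnit_iff]
    refine le_antisymm (PadicInt.norm_le_one _) (not_lt.1 fun hlt => ?_)
    rw [PadicInt.norm_int_lt_one_iff_dvd] at hlt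
    exact (Int.not_even_iff_odd.2 hodd) (even_iff_two_dvd.2 (by exact_mod_cast hlt))
  refine ⟨hu.unit, Units.ext ?_, ?_⟩
  · change PadicInt.toZModPow (p := 2) s (((σ : SL(2, ℤ)) 1 1 : ℤ) : ℤ_[2]) = 1
    rw [map_intCast, hσ]
  · rw [IsLift, IsUnit.unit_spec, map_intCast]

/-! ### The control theorem -/

section Comparison

variable {R H K H' : Type*} [CommRing R] [AddCommGroup H] [Module R H] [AddCommGroup K] [Module R K]
  [AddCommGroup H'] [Module R H'] {U : Module.End R H} {W : Module.End R K} {U' : Module.End R H'}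
  {α : H →ₗ[R] K} {β : K →ₗ[R] H'} {θ : H' →ₗ[R] K} {k c : ℕ}

theorem pow_apply_of_comp_eq (h : α ∘ₗ U = W ∘ₗ α) (n : ℕ) (x : H) :
    α ((U ^ n) x) = (W ^ n) (α x) := by
  induction n with
  | zero => rfl
  | succ n ih =>
    rw [pow_succ', pow_succ', Module.End.mul_apply, Module.End.mul_apply, ← ih]
    exact LinearMap.congr_fun h _

/-- In H → K → H', θ y lifts U'^k y to K, and W^c moves this lift into the image of α. -/
theorem exists_apply_eq_pow (hβ : β ∘ₗ W = U' ∘ₗ β) (hθ : β ∘ₗ θ = U' ^ k)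
    (hc : ∀ x, (W ^ c) x ∈ LinearMap.range α) (y : H') : ∃ h, β (α h) = (U' ^ (c + k)) y := by
  obtain ⟨h, hh⟩ := hc (θ y)
  refine ⟨h, ?_⟩
  rw [hh, pow_apply_of_comp_eq hβ, pow_add, Module.End.mul_apply, ← hθ, LinearMap.comp_apply]

/-- Choose z with α z = W^c (θ x). Since W^k = θ β, a divisibility known in H' pulls back to K, and
W^c then carries it to H modulo ker α. -/
theorem exists_apply_sub_eq_zero (hα : α ∘ₗ U = W ∘ₗ α) (hβ : β ∘ₗ W = U' ∘ₗ β)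
    (hθ : θ ∘ₗ β = W ^ k) (hc : ∀ x, (W ^ c) x ∈ LinearMap.range α) {a : R} {h : H} {m : ℕ} {x : H'}
    (hx : (U' ^ m) (β (α h)) = a • x) : ∃ z, α ((U ^ (c + (k + m))) h - a • z) = 0 := by
  obtain ⟨z, hz⟩ := hc (θ x)
  refine ⟨z, ?_⟩
  rw [map_sub, map_smul, hz, pow_apply_of_comp_eq hα, pow_add, pow_add, Module.End.mul_apply,
    Module.End.mul_apply, ← hθ, LinearMap.comp_apply, pow_apply_of_comp_eq hβ, hx, map_smul,
    map_smul, sub_self]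

end Comparison

section ControlHypotheses

variable {N r s : ℕ} (hN : Nat.Coprime 2 N) (hs : 1 < s) (hsr : s ≤ r)

theorem levelMap_atkinU (hs : s ≠ 0) (m : Homology (N * 2 ^ r)) :
    levelMap (mul_dvd_mul_left N (pow_dvd_pow 2 hsr)) (atkinU (N * 2 ^ r) m) =
      atkinU (N * 2 ^ s) (levelMap (mul_dvd_mul_left N (pow_dvd_pow 2 hsr)) m) := by
  have hP := isOddLevel_Gamma1 (M := N * 2 ^ r)
    (Dvd.dvd.mul_left (dvd_pow_self 2 (by omega)) N)
  have hQ := isOddLevel_Gamma1 (M := N * 2 ^ s) (Dvd.dvd.mul_left (dvd_pow_self 2 hs) N)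
  have hle := Gamma1_le_of_dvd (mul_dvd_mul_left N (pow_dvd_pow 2 hsr))
  exact (LinearMap.congr_fun (H1hecke_comp_H1incl hP hQ hle hle (conjInto_Gamma1 _)
    (conjInto_Gamma1 _)) m).symm

theorem Gamma1_le_midGroup (hsr : s ≤ r) : Gamma1 (N * 2 ^ r) ≤ midGroup (N * 2 ^ s) r :=
  le_inf (Gamma1_le_of_dvd (mul_dvd_mul_left N (pow_dvd_pow 2 hsr)))
    ((Gamma1_in_Gamma0 _).trans (Gamma0_le_of_dvd (dvd_mul_left _ _)))

theorem midGroup_le_Phi (hs : 1 < s) : midGroup (N * 2 ^ s) r ≤ Phi N r :=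
  inf_le_inf_right _ (Gamma1_le_of_dvd (mul_dvd_mul_left N (pow_dvd_pow 2 hs)))

include hN hs in
theorem mem_Gamma1_of_mem_midGroup {γ : SL(2, ℤ)} (hγ : γ ∈ midGroup (N * 2 ^ s) r)
    (h : ((γ 1 1 : ℤ) : ZMod (2 ^ r)) = 1) : γ ∈ Gamma1 (N * 2 ^ r) := by
  refine mem_Gamma1_of_mem_Gamma0 (Phi_le hN r (midGroup_le_Phi hs hγ)) ?_
  have h1 := intCast_eq_of_dvd (M' := N) (dvd_mul_right N (2 ^ s)) (b := 1)
    (by simpa using apply_eq_one_of_mem_Gamma1 hγ.1)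
  simpa using intCast_eq_of_coprime (hN.symm.pow_right r) h1 (by simpa using h)

/-- The endomorphisms of `Γ₁(N 2^r)^ab ⊗ ℤ₂` through which the elements of `Γ_s` act. -/
def nebentypusSet (r s : ℕ) : Set (Module.End ℤ_[2] (Homology (N * 2 ^ r))) :=
  {f | ∃ γ ∈ Gam s, ∃ σ : Phi N r, IsLift σ γ ∧ f = conjAct hN σ}

include hs hsr in
theorem mem_augSpan_of_H1incl_eq_zero (x : Homology (N * 2 ^ r))
    (hx : H1incl (Gamma1_le_midGroup hsr) x = 0) : x ∈ augSpan (nebentypusSet hN r s) := by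
  -- The condition s > 1 enters here: lower right entries congruent to 1 mod 4 give a cyclic
  -- quotient, whereas (ℤ/2^r)ˣ is not cyclic for r ≥ 3.
  have h4 : 4 ∣ N * 2 ^ s := Dvd.dvd.mul_left (pow_dvd_pow 2 hs : 2 ^ 2 ∣ 2 ^ s) N
  obtain ⟨g, hg, hgen⟩ := exists_generator h4 (by omega : 2 ≤ r)
  let σ : Phi N r := ⟨g, midGroup_le_Phi hs hg⟩
  have hσ : (((σ : SL(2, ℤ)) 1 1 : ℤ) : ZMod (2 ^ s)) = 1 := by
    simpa using intCast_eq_of_dvd (M' := 2 ^ s) (dvd_mul_left _ N) (b := 1)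
      (by simpa using apply_eq_one_of_mem_Gamma1 hg.1)
  obtain ⟨γ, hγ, hlift⟩ := exists_isLift σ hσ
  have hnorm : mapGL ℚ g ∈ Subgroup.normalizer
      (imGL (Gamma1 (N * 2 ^ r)) : Set (GL (Fin 2) ℚ)) := by
    rw [Subgroup.mem_normalizer_iff]
    intro y
    exact (conj_mem_G1_iff (Phi_le hN r σ.2)).symm
  obtain ⟨y, hy⟩ := exists_sub_eq_of_H1incl_eq_zero (Gamma1_le_midGroup hsr) hg hnorm
    (fun x hx => by
      obtain ⟨n, y, hy, hy1, h⟩ := hgen x hx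
      exact ⟨n, y, mem_Gamma1_of_mem_midGroup hN hs hy hy1, h⟩)
    (conjG1 hN σ) (conjG1_apply hN σ) x hx
  exact Submodule.subset_span ⟨_, ⟨γ, hγ, σ, hlift, rfl⟩, y, hy.symm⟩

/-- `Γ₁(N 2^r)^ab ⊗ ℤ₂ → Γ₁(N 2^s)^ab ⊗ ℤ₂` factors through the homology of
`Γ₁(N 2^s) ∩ Γ₀(2^r)`. -/
theorem levelMap_eq (m : Homology (N * 2 ^ r)) :
    levelMap (mul_dvd_mul_left N (pow_dvd_pow 2 hsr)) m =
      H1incl (midGroup_le (N * 2 ^ s) r) (H1incl (Gamma1_le_midGroup hsr) m) :=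
  (LinearMap.congr_fun (H1incl_comp (Gamma1_le_midGroup (N := N) hsr) (midGroup_le _ r)) m).symm

theorem exists_factor_pow_of_le (hM : 2 ∣ N * 2 ^ s) (hsr : s ≤ r) :
    ∃ θ : H1 (Gamma1 (N * 2 ^ s)) →ₗ[ℤ_[2]] H1 (midGroup (N * 2 ^ s) r),
      H1incl (midGroup_le (N * 2 ^ s) r) ∘ₗ θ = gammaU hM ^ (r - s) ∧
      θ ∘ₗ H1incl (midGroup_le (N * 2 ^ s) r) = midU hM r ^ (r - s) := by
  obtain ⟨j, rfl⟩ := Nat.exists_eq_add_of_le hsr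
  rw [Nat.add_sub_cancel_left]
  exact exists_factor_pow hM (dvd_mul_left (2 ^ s) N) j

include hN hs in
theorem exists_pow_mem_range_levelMap : ∃ n : ℕ, ∀ y : Homology (N * 2 ^ s),
    (atkinU (N * 2 ^ s) ^ n) y ∈
      LinearMap.range (levelMap (mul_dvd_mul_left N (pow_dvd_pow 2 hsr))) := by
  have hM : 2 ∣ N * 2 ^ s := Dvd.dvd.mul_left (dvd_pow_self 2 (by omega)) N
  obtain ⟨θ, h1, -⟩ := exists_factor_pow_of_le hM hsr
  -- The factor U^(r-s) lifts to Γ₁(N2^s) ∩ Γ₀(2^r), and U^r kills the cokernel from Γ₁(N2^r).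
  exact ⟨r + (r - s), fun y => (exists_apply_eq_pow (H1incl_comp_midU hM r) h1
    (midU_pow_mem_range hM (by omega) (Gamma1_le_midGroup hsr)
      fun γ => mem_Gamma1_of_mem_midGroup hN hs) y).imp fun m hm => (levelMap_eq hsr m).trans hm⟩

theorem exists_sub_mem_augSpan (hs : 1 < s) (hsr : s ≤ r) (h : Homology (N * 2 ^ r))
    (hh : ∀ k : ℕ, ∃ (m : ℕ) (x : Homology (N * 2 ^ s)), (atkinU (N * 2 ^ s) ^ m)
      (levelMap (mul_dvd_mul_left N (pow_dvd_pow 2 hsr)) h) = (2 ^ k : ℤ_[2]) • x) (k : ℕ) :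
    ∃ (m : ℕ) (x : Homology (N * 2 ^ r)),
      (atkinU (N * 2 ^ r) ^ m) h - (2 ^ k : ℤ_[2]) • x ∈ augSpan (nebentypusSet hN r s) := by
  have hM : 2 ∣ N * 2 ^ s := Dvd.dvd.mul_left (dvd_pow_self 2 (by omega)) N
  have hM' : 2 ∣ N * 2 ^ r := Dvd.dvd.mul_left (dvd_pow_self 2 (by omega)) N
  obtain ⟨θ, -, h2⟩ := exists_factor_pow_of_le hM hsr
  obtain ⟨m, x, hx⟩ := hh k
  obtain ⟨z, hz⟩ := exists_apply_sub_eq_zero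
    (H1hecke_comp_H1incl (isOddLevel_Gamma1 hM') (isOddLevel_midGroup hM r)
      (Gamma1_le_midGroup hsr) (Gamma1_le_midGroup hsr) (conjInto_Gamma1 _)
      (conjInto_midGroup _ r)).symm
    (H1incl_comp_midU hM r) h2 (midU_pow_mem_range hM (by omega) (Gamma1_le_midGroup hsr)
      fun γ => mem_Gamma1_of_mem_midGroup hN hs)
    ((congrArg _ (levelMap_eq hsr h).symm).trans hx)
  exact ⟨r + ((r - s) + m), z, mem_augSpan_of_H1incl_eq_zero hN hs hsr _ hz⟩

theorem finite_homology {M : ℕ} (hM : M ≠ 0) : Module.Finite ℤ_[2] (Homology M) :=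
  have : NeZero M := ⟨hM⟩
  finite_H1 (Gamma1 M)

end ControlHypotheses

end TwoAdicControl

end

open TwoAdicControl in
theorem mainTheorem2 (N r s : ℕ) (hN : Nat.Coprime 2 N) (hs : 1 < s) (hsr : s ≤ r) :
    -- the map induced by the inclusion commutes with `U`
    (∀ m : TwoAdicControl.Homology (N * 2 ^ r),
      TwoAdicControl.levelMap (mul_dvd_mul_left N (pow_dvd_pow 2 hsr))
          (TwoAdicControl.atkinU (N * 2 ^ r) m) =
        TwoAdicControl.atkinU (N * 2 ^ s)
          (TwoAdicControl.levelMap (mul_dvd_mul_left N (pow_dvd_pow 2 hsr)) m)) ∧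
    -- the nebentypus action commutes with `U`
    (∀ σ : TwoAdicControl.Phi N r,
      Commute (TwoAdicControl.conjAct hN σ) (TwoAdicControl.atkinU (N * 2 ^ r))) ∧
    -- exactly one map between the ordinary parts, modulo `𝔞_s`, is induced by the inclusion
    (∃! φ : (TwoAdicControl.OrdPart (TwoAdicControl.atkinU (N * 2 ^ r)) ⧸
          TwoAdicControl.augOrd hN r s) →ₗ[ℤ_[2]]
        TwoAdicControl.OrdPart (TwoAdicControl.atkinU (N * 2 ^ s)),
      TwoAdicControl.IsInduced hN hsr φ) ∧
    -- and it is an isomorphism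
    (∀ φ : (TwoAdicControl.OrdPart (TwoAdicControl.atkinU (N * 2 ^ r)) ⧸
          TwoAdicControl.augOrd hN r s) →ₗ[ℤ_[2]]
        TwoAdicControl.OrdPart (TwoAdicControl.atkinU (N * 2 ^ s)),
      TwoAdicControl.IsInduced hN hsr φ → Function.Bijective φ) := by 
  have hM : 2 ∣ N * 2 ^ s := Dvd.dvd.mul_left (dvd_pow_self 2 (by omega)) N
  have hN0 : N ≠ 0 := by
    rintro rfl
    norm_num at hN
  have hfin := finite_homology (mul_ne_zero hN0 (pow_ne_zero r two_ne_zero))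
  have hfin' := finite_homology (mul_ne_zero hN0 (pow_ne_zero s two_ne_zero))
  have hπ := levelMap_atkinU (N := N) hsr (by omega)
  have hcomm := conjAct_commute (N := N) (r := r) hN (by omega)
  have hS : ∀ f ∈ nebentypusSet hN r s, Commute f (atkinU (N * 2 ^ r)) := by
    rintro f ⟨γ, -, σ, -, rfl⟩
    exact hcomm σ
  have hπS : ∀ f ∈ nebentypusSet hN r s, ∀ m,
      levelMap (mul_dvd_mul_left N (pow_dvd_pow 2 hsr)) (f m) =
        levelMap (mul_dvd_mul_left N (pow_dvd_pow 2 hsr)) m := by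
    rintro f ⟨γ, hγ, σ, hσ, rfl⟩ m
    exact levelMap_conjAct hN hsr (apply_eq_one_of_isLift hsr hσ hγ) m
  obtain ⟨h1, h2⟩ := ordinary_control (nebentypusSet hN r s) hS
    (levelMap (mul_dvd_mul_left N (pow_dvd_pow 2 hsr))) hπ hπS
    (exists_pow_mem_range_levelMap hN hs hsr)
    (exists_sub_mem_augSpan hN hs hsr)
  exact ⟨hπ, hcomm, h1, h2⟩
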